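/- Consider fractional packing linear programs with $n \ge 1$ agents and $m \ge 1$ resources. Agent $i$ has a private value $v_i \in [0,1]$ and private demands $a_{ij} \in [0,1]$, $1 \le j \le m$; every resource has the same public supply $b > 0$. The program is to maximize $\sum_i v_i x_i$ subject to $\sum_i a_{ij} x_i \le b$ for all $j$ and $0 \le x_i \le 1$ for all $i$. A randomized mechanism that maps datasets of $n$ agents to allocations $x \in [0,1]^n$ is $(\epsilon,\delta)$-jointly differentially private if for every agent $i$, all datasets $\mathcal D, \mathcal D'$ that differ at most in the data of agent $i$, and every measurable set $S$ of allocations to the agents other than $i$, $\Pr[\mathcal M(\mathcal D)_{-i} \in S] \le e^{\epsilon} \Pr[\mathcal M(\mathcal D')_{-i} \in S] + \delta$. Algorithms are programs for a real-number random access machine: integer registers with $+$, truncated $-$, $\times$ and comparisons; arrays of real numbers with $+,-,\times,/,\exp,\ln$ and comparisons; no rounding from reals to integers; natural numbers as the only constants; and a fresh independent uniform random number from $[0,1]$ on request. Each operation takes one step. Theorem. There are one such program, with input $n, m, \epsilon, \delta, \alpha, b$ and the data $v_i, a_{ij}$, absolute constants $C$ and $k \in \mathbb N$, and a function $\tau$,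 such that for all $n, m \ge 1$, $\delta, \alpha \in (0,1)$, $0 < \epsilon \le 1 + \ln(1/\delta)$ and $b > 0$: 0. the program is $(\epsilon,\delta)$-jointly differentially private; 1. for every dataset and every $\beta \in (0,1)$, if $$b \;\ge\; C \cdot \frac{\sqrt m}{\alpha \epsilon} \cdot \ln^k\!\Big(m + \frac1\alpha + \frac1\delta + \frac1\beta\Big),$$ then with probability at least $1-\beta$ the program returns a feasible solution $x$ of the packing linear program whose objective is at most $\alpha n$ below that of any feasible solution; 2. for every dataset, with probability $1$ the program halts with an allocation in $[0,1]^n$ after at most $\tau(m,\epsilon,\delta,\alpha) \cdot n$ steps. -/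

import Mathlib

open MeasureTheory

/-! Randomised real-RAM programs with a step count. -/

namespace RealRAM

/-- Expressions over natural numbers (loop counters and addresses); `reg x` is the content of the
integer register number `x`, and `sub` is truncated subtraction. -/
inductive NatExpr : Type
  | const (c : ℕ)
  | reg (x : ℕ)
  | add (e f : NatExpr)
  | sub (e f : NatExpr)
  | mul (e f : NatExpr)

/-- Expressions over real numbers; `read k e` is the entry with index `e` of the real array
number `k`. There is no rounding from the reals to the integers, and the only constants are
natural numbers. -/
inductive RealExpr : Type
  | cast (e : NatExpr)
  | read (k : ℕ) (e : NatExpr)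
  | add (e f : RealExpr)
  | sub (e f : RealExpr)
  | mul (e f : RealExpr)
  | div (e f : RealExpr)
  | exp (e : RealExpr)
  | log (e : RealExpr)

/-- Tests for branching. -/
inductive Test : Type
  | natLt (e f : NatExpr)
  | realLt (e f : RealExpr)

/-- Programs. `sample k e` writes a fresh uniform random number in `[0, 1]` into the entry with
index `e` of the array number `k`. -/
inductive Program : Type
  | setNat (x : ℕ) (e : NatExpr)
  | setReal (k : ℕ) (i : NatExpr) (e : RealExpr)
  | sample (k : ℕ) (i : NatExpr)
  | seq (P Q : Program)
  | branch (c : Test) (P Q : Program)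
  | loop (c : Test) (P : Program)

/-- A memory configuration: integer registers, real arrays, and the number of random numbers that
have been drawn so far. -/
structure State : Type where
  nat : ℕ → ℕ
  real : ℕ → ℕ → ℝ
  drawn : ℕ

def NatExpr.eval (s : State) : NatExpr → ℕ
  | const c => c
  | reg x => s.nat x
  | add e f => e.eval s + f.eval s
  | sub e f => e.eval s - f.eval s
  | mul e f => e.eval s * f.eval s

/-- Number of steps spent on evaluating an expression: one per node. -/
def NatExpr.cost : NatExpr → ℕ
  | const _ => 1
  | reg _ => 1
  | add e f => e.cost + f.cost + 1
  | sub e f => e.cost + f.cost + 1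
  | mul e f => e.cost + f.cost + 1

noncomputable def RealExpr.eval (s : State) : RealExpr → ℝ
  | cast e => (e.eval s : ℝ)
  | read k e => s.real k (e.eval s)
  | add e f => e.eval s + f.eval s
  | sub e f => e.eval s - f.eval s
  | mul e f => e.eval s * f.eval s
  | div e f => e.eval s / f.eval s
  | exp e => Real.exp (e.eval s)
  | log e => Real.log (e.eval s)

def RealExpr.cost : RealExpr → ℕ
  | cast e => e.cost + 1
  | read _ e => e.cost + 1
  | add e f => e.cost + f.cost + 1
  | sub e f => e.cost + f.cost + 1
  | mul e f => e.cost + f.cost + 1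
  | div e f => e.cost + f.cost + 1
  | exp e => e.cost + 1
  | log e => e.cost + 1

def Test.Holds (s : State) : Test → Prop
  | natLt e f => e.eval s < f.eval s
  | realLt e f => e.eval s < f.eval s

def Test.cost : Test → ℕ
  | natLt e f => e.cost + f.cost + 1
  | realLt e f => e.cost + f.cost + 1

def State.setNat (s : State) (x v : ℕ) : State :=
  { s with nat := Function.update s.nat x v }

noncomputable def State.setReal (s : State) (k i : ℕ) (v : ℝ) : State :=
  { s with real := Function.update s.real k (Function.update (s.real k) i v) }

/-- `Exec ω P s s' t`: with the random numbers `ω 0, ω 1, …`, the program `P` started in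
configuration `s` halts in configuration `s'` after exactly `t` steps. -/
inductive Exec (ω : ℕ → unitInterval) : Program → State → State → ℕ → Prop
  | setNat (x : ℕ) (e : NatExpr) (s : State) :
      Exec ω (.setNat x e) s (s.setNat x (e.eval s)) (e.cost + 1)
  | setReal (k : ℕ) (i : NatExpr) (e : RealExpr) (s : State) :
      Exec ω (.setReal k i e) s (s.setReal k (i.eval s) (e.eval s)) (i.cost + e.cost + 1)
  | sample (k : ℕ) (i : NatExpr) (s : State) :
      Exec ω (.sample k i) s
        { s.setReal k (i.eval s) (ω s.drawn : ℝ) with drawn := s.drawn + 1 } (i.cost + 1)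
  | seq {P Q : Program} {s s' s'' : State} {t t' : ℕ} :
      Exec ω P s s' t → Exec ω Q s' s'' t' → Exec ω (.seq P Q) s s'' (t + t')
  | branch_true {c : Test} {P Q : Program} {s s' : State} {t : ℕ} :
      c.Holds s → Exec ω P s s' t → Exec ω (.branch c P Q) s s' (c.cost + t)
  | branch_false {c : Test} {P Q : Program} {s s' : State} {t : ℕ} :
      ¬ c.Holds s → Exec ω Q s s' t → Exec ω (.branch c P Q) s s' (c.cost + t)
  | loop_true {c : Test} {P : Program} {s s' s'' : State} {t t' : ℕ} :
      c.Holds s → Exec ω P s s' t → Exec ω (.loop c P) s' s'' t' →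
      Exec ω (.loop c P) s s'' (c.cost + t + t')
  | loop_false {c : Test} {P : Program} {s : State} :
      ¬ c.Holds s → Exec ω (.loop c P) s s c.cost

/-- A run is determined by the program, the start and the random numbers. -/
theorem Exec.deterministic {ω : ℕ → unitInterval} {P : Program} {s s₁ s₂ : State} {t₁ t₂ : ℕ}
    (h₁ : Exec ω P s s₁ t₁) (h₂ : Exec ω P s s₂ t₂) : s₁ = s₂ ∧ t₁ = t₂ := by
  induction h₁ generalizing s₂ t₂ with
  | setNat => cases h₂; exact ⟨rfl, rfl⟩
  | setReal => cases h₂; exact ⟨rfl, rfl⟩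
  | sample => cases h₂; exact ⟨rfl, rfl⟩
  | seq _ _ ih ih' =>
    cases h₂ with
    | seq a a' =>
      obtain ⟨rfl, rfl⟩ := ih a
      obtain ⟨rfl, rfl⟩ := ih' a'
      exact ⟨rfl, rfl⟩
  | branch_true hc _ ih =>
    cases h₂ with
    | branch_true _ a => obtain ⟨rfl, rfl⟩ := ih a; exact ⟨rfl, rfl⟩
    | branch_false hn _ => exact absurd hc hn
  | branch_false hc _ ih =>
    cases h₂ with
    | branch_true hn _ => exact absurd hn hc
    | branch_false _ a => obtain ⟨rfl, rfl⟩ := ih a; exact ⟨rfl, rfl⟩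
  | loop_true hc _ _ ih ih' =>
    cases h₂ with
    | loop_true _ a a' =>
      obtain ⟨rfl, rfl⟩ := ih a
      obtain ⟨rfl, rfl⟩ := ih' a'
      exact ⟨rfl, rfl⟩
    | loop_false hn => exact absurd hc hn
  | loop_false hc =>
    cases h₂ with
    | loop_true hn _ _ => exact absurd hn hc
    | loop_false _ => exact ⟨rfl, rfl⟩

/-- The law of an infinite sequence of independent uniform random numbers in `[0, 1]`. -/
noncomputable def coins : Measure (ℕ → unitInterval) :=
  Measure.infinitePi (fun _ : ℕ => (volume : Measure unitInterval))

end RealRAM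

/-! Fractional packing and joint differential privacy. -/

namespace PrivatePacking

open RealRAM

/-- The private data of one agent, a point of `[0, 1] ^ (m + 1)`: her value and her demand for each
of the `m` resources. -/
structure Agent (m : ℕ) : Type where
  value : unitInterval
  demand : Fin m → unitInterval

/-- A dataset of `n` agents. -/
abbrev Dataset (n m : ℕ) : Type := Fin n → Agent m

/-- `x` is feasible for the packing linear program with supply `b` of each resource. -/
def Feasible {n m : ℕ} (D : Dataset n m) (b : ℝ) (x : Fin n → ℝ) : Prop :=
  (∀ i, 0 ≤ x i ∧ x i ≤ 1) ∧ ∀ j, ∑ i, ((D i).demand j : ℝ) * x i ≤ b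

/-- The objective of the packing linear program. -/
def objective {n m : ℕ} (D : Dataset n m) (x : Fin n → ℝ) : ℝ :=
  ∑ i, ((D i).value : ℝ) * x i

/-- `x` is feasible, and optimal up to an additive error `γ`. -/
def IsNearOptimal {n m : ℕ} (D : Dataset n m) (b γ : ℝ) (x : Fin n → ℝ) : Prop :=
  Feasible D b x ∧ ∀ y, Feasible D b y → objective D y ≤ objective D x + γ

/-- `D` and `D'` differ at most in the data of agent `i`. -/
def Neighbors {n m : ℕ} (i : Fin n) (D D' : Dataset n m) : Prop :=
  ∀ j, j ≠ i → D j = D' j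

/-- Joint differential privacy of a randomised mechanism that allocates to `n` agents. The
randomness is drawn from `μ`, and `M D ω x` says that on dataset `D` and randomness `ω` the
mechanism returns the allocation `x`. -/
def JointlyPrivate {n m : ℕ} {Ω : Type*} [MeasurableSpace Ω] (μ : Measure Ω)
    (M : Dataset n m → Ω → (Fin n → ℝ) → Prop) (ε δ : ℝ) : Prop :=
  ∀ (i : Fin n) (D D' : Dataset n m), Neighbors i D D' →
    ∀ S : Set ({j : Fin n // j ≠ i} → ℝ), MeasurableSet S →
      μ {ω | ∃ x, M D ω x ∧ (fun j : {j : Fin n // j ≠ i} => x j) ∈ S} ≤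
        ENNReal.ofReal (Real.exp ε) *
          μ {ω | ∃ x, M D' ω x ∧ (fun j : {j : Fin n // j ≠ i} => x j) ∈ S} +
        ENNReal.ofReal δ

/-- The initial memory. Integer registers 0 and 1 hold `n` and `m`; array 0 holds the parameters
`ε, δ, α, b`; array 1 holds the values; array 2 holds the demands, row by row (the demand of agent
`i` for resource `j` has index `i * m + j`). Everything else is zero. -/
noncomputable def initial {n m : ℕ} (ε δ α b : ℝ) (D : Dataset n m) : State where
  nat := fun x => if x = 0 then n else if x = 1 then m else 0
  real := fun k l =>
    if k = 0 then
      if l = 0 then ε else if l = 1 then δ else if l = 2 then α else if l = 3 then b else 0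
    else if k = 1 then
      if h : l < n then ((D ⟨l, h⟩).value : ℝ) else 0
    else if k = 2 then
      if h : l < n * m then
        ((D (finProdFinEquiv.symm (⟨l, h⟩ : Fin (n * m))).1).demand
          (finProdFinEquiv.symm (⟨l, h⟩ : Fin (n * m))).2 : ℝ)
      else 0
    else 0
  drawn := 0

/-- The allocation in a memory configuration: the first `n` entries of array 3. -/
def allocation (n : ℕ) (s : State) : Fin n → ℝ := fun i => s.real 3 i

/-- On the given input and randomness `ω`, the program `P` halts after `t` steps with the
allocation `x`. -/
def Returns (P : Program) {n m : ℕ} (ε δ α b : ℝ) (D : Dataset n m)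
    (ω : ℕ → unitInterval) (x : Fin n → ℝ) (t : ℕ) : Prop :=
  ∃ s : State, Exec ω P (initial ε δ α b D) s t ∧ allocation n s = x

end PrivatePacking

/-!
The mechanism is a dual multiplicative weights method that uses all agents in every round. It keeps
a cumulative noisy excess load `S j` for each resource, posts prices proportional to
`exp (rate * S j)` (with a dummy resource that absorbs the rest of the total price `cap`), lets each
agent buy if and only if her demand costs less than her value, and adds the resulting load, minus a
slightly reduced supply, plus logistic noise, to `S`. The allocation of an agent is the average of
her responses. It depends only on her own data and on the noisy loads, so joint differential privacy
reduces to differential privacy of the noisy loads.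

*Privacy.* The noisy loads are answers to `rounds * m` adaptive queries that change by at most `1`
when one agent changes. Translating the logistic law by at most `1` (on the noise scale `l`) gives a
likelihood ratio `r` with `|log r| ≤ 1 / l` and mean `1`, hence `E r ^ q ≤ exp (q² / (2 l²))`
(`lintegral_logisticRatio_rpow_le`). In the Hölder form `E G ≤ c * (E' G ^ p) ^ (1 / p)` this bound
is multiplicative under adaptive composition (`lintegral_transcript_le`), and Young's inequality
turns it into `(ε, δ)`-privacy (`coins_transcript_le`). A noise scale of order
`√(rounds * m) / ε`, up to a logarithm, suffices.

*Accuracy.* Every resource also has a base price, so a buying agent has small demand and the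
load stays below `width = 4 m b / α`; this is what makes a number of rounds that does not depend on
`n` or `b` possible. The potential is the logarithm of the normaliser of the weights. Its growth in
a round is split: the noiseless part is bounded deterministically by the payments for the excess load
plus `(rate * width)²` (`Valid.log_normalizer_noiseless_le`), and the `exponent`-th power of the noisy
part is a supermartingale up to a constant factor per round (`lintegral_prod_noiseGrowth_le`).
Raising it to this power is what keeps the failure probability from entering the choice of the learning rate. Best
responses maximise the Lagrangian, so the payments are at most the gain in value over any competitor
(`lagrangian_le`). That the potential is nonnegative gives near-optimality, and that it dominates
`rate * S j` bounds the violation of each constraint, which the reduced supply absorbs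
(`Valid.isNearOptimal`).

*Running time.* `exec_mechanism` verifies a program that computes this allocation for every outcome
of the random numbers. The number of rounds is the square of a rounded-up real number, which the
program finds by counting, so that its square root is available as an integer.
-/

/-! ### The mechanism -/

namespace PrivatePacking

/-- The public parameters of an instance with `n` agents and `m` resources. -/
structure Params (n m : ℕ) : Type where
  ε : ℝ
  δ : ℝ
  α : ℝ
  b : ℝ

/-- The ranges of the parameters for which the mechanism is analysed. -/
structure Params.Valid {n m : ℕ} (p : Params n m) : Prop where
  n_pos : 1 ≤ n
  m_pos : 1 ≤ m
  δ_pos : 0 < p.δ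
  δ_lt : p.δ < 1
  ε_pos : 0 < p.ε
  ε_le : p.ε ≤ 1 + Real.log (1 / p.δ)
  α_pos : 0 < p.α
  α_lt : p.α < 1
  b_pos : 0 < p.b

namespace Params

variable {n m : ℕ} (p : Params n m)

/-- The logarithmic factor `1 + ln ((m + 1) / δ)`; it dominates `1`, `ln (m + 1)` and
`ln (1 / δ)`. -/
noncomputable def logFactor : ℝ := 1 + Real.log ((m + 1) / p.δ)

/-- The square root of the number of rounds. Taking the number of rounds to be a square makes its
square root available to the program. -/
noncomputable def side : ℕ := ⌈256 * p.logFactor * m / (p.α * p.α)⌉₊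

/-- The number of rounds, as a real number. -/
noncomputable def rounds : ℝ := (p.side : ℝ) * p.side

/-- The scale of the noise that is added to each coordinate of the load in each round. -/
noncomputable def noiseScale : ℝ := 2 * p.side * √m * p.logFactor / p.ε

/-- The learning rate of the multiplicative weights. -/
noncomputable def rate : ℝ := 64 * p.logFactor / (p.α * p.b * p.rounds)

/-- The supply that the prices steer towards; the gap to `b` absorbs the noise. -/
noncomputable def target : ℝ := p.b - p.α * p.b / 4

/-- The total price that the multiplicative weights distribute over the resources (and over a
dummy resource). -/
noncomputable def cap : ℝ := 4 * n / p.b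

/-- The base price of each resource. It keeps agents from buying whose demand is so large that
the load would not be bounded by a multiple of the supply. -/
noncomputable def base : ℝ := p.α * n / (4 * m * p.b)

/-- The normaliser of the multiplicative weights; the summand `1` belongs to a dummy resource. -/
noncomputable def normalizer (S : Fin m → ℝ) : ℝ := 1 + ∑ j, Real.exp (p.rate * S j)

/-- The multiplicative weight of a resource after the cumulative noisy excess load `S`. -/
noncomputable def weight (S : Fin m → ℝ) (j : Fin m) : ℝ :=
  Real.exp (p.rate * S j) / p.normalizer S

/-- The price of a resource after the cumulative noisy excess load `S`. -/
noncomputable def price (S : Fin m → ℝ) (j : Fin m) : ℝ := p.base + p.cap * p.weight S j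

open Classical in
/-- The best response of an agent to the prices: `1` if her demand costs less than her value, and
`0` otherwise. -/
noncomputable def buys (S : Fin m → ℝ) (A : Agent m) : ℝ :=
  if ∑ j, (A.demand j : ℝ) * p.price S j < A.value then 1 else 0

/-- The load of a resource under the best responses. -/
noncomputable def load (D : Dataset n m) (S : Fin m → ℝ) (j : Fin m) : ℝ :=
  ∑ i, ((D i).demand j : ℝ) * p.buys S (D i)

end Params

/-- The log-odds of a uniform random number, which follow the standard logistic law. -/
noncomputable def logit (u : unitInterval) : ℝ := Real.log ((u : ℝ) / (1 - u))

variable {n m : ℕ} (p : Params n m)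

/-- The cumulative noisy excess load after `t` rounds, computed with the random numbers `ω`; round
`t` uses the random numbers from `t * m` on. -/
noncomputable def dualState (D : Dataset n m) (ω : ℕ → unitInterval) : ℕ → Fin m → ℝ
  | 0 => 0
  | t + 1 => fun j => dualState D ω t j +
      (p.load D (dualState D ω t) j - p.target + p.noiseScale * logit (ω (t * m + j)))

/-- The allocation of the mechanism: the average of the best responses over all rounds. -/
noncomputable def output (D : Dataset n m) (ω : ℕ → unitInterval) (i : Fin n) : ℝ :=
  ∑ t ∈ Finset.range (p.side * p.side), p.buys (dualState p D ω t) (D i) / p.rounds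

end PrivatePacking

/-! ### Total correctness of programs -/

namespace RealRAM

instance (k : ℕ) : OfNat NatExpr k := ⟨.const k⟩
instance : Add NatExpr := ⟨.add⟩
instance : Mul NatExpr := ⟨.mul⟩
instance (k : ℕ) : OfNat RealExpr k := ⟨.cast (.const k)⟩
instance : Add RealExpr := ⟨.add⟩
instance : Sub RealExpr := ⟨.sub⟩
instance : Mul RealExpr := ⟨.mul⟩
instance : Div RealExpr := ⟨.div⟩

section Eval
variable (s : State)

@[simp] theorem NatExpr.eval_ofNat (k : ℕ) :
    NatExpr.eval s (no_index (OfNat.ofNat k)) = OfNat.ofNat k := rfl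
@[simp] theorem NatExpr.eval_reg (x : ℕ) : NatExpr.eval s (.reg x) = s.nat x := rfl
@[simp] theorem NatExpr.eval_add (e f : NatExpr) : (e + f).eval s = e.eval s + f.eval s := rfl
@[simp] theorem NatExpr.eval_mul (e f : NatExpr) : (e * f).eval s = e.eval s * f.eval s := rfl
@[simp] theorem RealExpr.eval_ofNat (k : ℕ) :
    RealExpr.eval s (no_index (OfNat.ofNat k)) = ((OfNat.ofNat k : ℕ) : ℝ) := rfl
@[simp] theorem RealExpr.eval_cast (e : NatExpr) : RealExpr.eval s (.cast e) = (e.eval s : ℝ) := rfl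
@[simp] theorem RealExpr.eval_read (k : ℕ) (e : NatExpr) :
    RealExpr.eval s (.read k e) = s.real k (e.eval s) := rfl
@[simp] theorem RealExpr.eval_add (e f : RealExpr) : (e + f).eval s = e.eval s + f.eval s := rfl
@[simp] theorem RealExpr.eval_sub (e f : RealExpr) : (e - f).eval s = e.eval s - f.eval s := rfl
@[simp] theorem RealExpr.eval_mul (e f : RealExpr) : (e * f).eval s = e.eval s * f.eval s := rfl
@[simp] theorem RealExpr.eval_div (e f : RealExpr) : (e / f).eval s = e.eval s / f.eval s := rfl
@[simp] theorem RealExpr.eval_exp (e : RealExpr) :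
    RealExpr.eval s (.exp e) = Real.exp (e.eval s) := rfl
@[simp] theorem RealExpr.eval_log (e : RealExpr) :
    RealExpr.eval s (.log e) = Real.log (e.eval s) := rfl

@[simp] theorem State.setNat_nat_same (x v : ℕ) : (s.setNat x v).nat x = v := by
  simp [State.setNat]
theorem State.setNat_nat_of_ne {x y : ℕ} (v : ℕ) (h : y ≠ x) : (s.setNat x v).nat y = s.nat y := by
  simp [State.setNat, h]
@[simp] theorem State.setNat_real (x v : ℕ) : (s.setNat x v).real = s.real := rfl
@[simp] theorem State.setNat_drawn (x v : ℕ) : (s.setNat x v).drawn = s.drawn := rfl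
@[simp] theorem State.setReal_nat (k i : ℕ) (v : ℝ) : (s.setReal k i v).nat = s.nat := rfl
@[simp] theorem State.setReal_real_same (k i : ℕ) (v : ℝ) :
    (s.setReal k i v).real k = Function.update (s.real k) i v := by
  simp [State.setReal]
theorem State.setReal_real_of_ne {k l : ℕ} (i : ℕ) (v : ℝ) (h : l ≠ k) :
    (s.setReal k i v).real l = s.real l := by
  simp [State.setReal, h]

end Eval

/-- Started in `s`, the program halts within `c` steps in a configuration that satisfies `Q`. -/
def Runs (ω : ℕ → unitInterval) (P : Program) (s : State) (c : ℕ) (Q : State → Prop) : Prop :=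
  ∃ s' t, Exec ω P s s' t ∧ t ≤ c ∧ Q s'

section Rules
variable {ω : ℕ → unitInterval} {P P' : Program} {s : State} {c c' : ℕ} {Q Q' : State → Prop}

theorem Runs.mono (h : Runs ω P s c Q) (hc : c ≤ c') (hQ : ∀ s', Q s' → Q' s') :
    Runs ω P s c' Q' := by
  obtain ⟨s', t, h₁, h₂, h₃⟩ := h
  exact ⟨s', t, h₁, h₂.trans hc, hQ _ h₃⟩

theorem Runs.seq (h : Runs ω P s c (fun s' => Runs ω P' s' c' Q)) :
    Runs ω (.seq P P') s (c + c') Q := by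
  obtain ⟨s', t, h₁, h₂, s'', t', h₃, h₄, h₅⟩ := h
  exact ⟨s'', t + t', .seq h₁ h₃, add_le_add h₂ h₄, h₅⟩

theorem runs_setNat {x : ℕ} {e : NatExpr} (h : Q (s.setNat x (e.eval s))) :
    Runs ω (.setNat x e) s (e.cost + 1) Q :=
  ⟨_, _, .setNat .., le_rfl, h⟩

theorem runs_setReal {k : ℕ} {i : NatExpr} {e : RealExpr}
    (h : Q (s.setReal k (i.eval s) (e.eval s))) :
    Runs ω (.setReal k i e) s (i.cost + e.cost + 1) Q :=
  ⟨_, _, .setReal .., le_rfl, h⟩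

theorem runs_sample {k : ℕ} {i : NatExpr}
    (h : Q { s.setReal k (i.eval s) (ω s.drawn : ℝ) with drawn := s.drawn + 1 }) :
    Runs ω (.sample k i) s (i.cost + 1) Q :=
  ⟨_, _, .sample .., le_rfl, h⟩

theorem runs_branch {t : Test} (h : t.Holds s → Runs ω P s c Q)
    (h' : ¬ t.Holds s → Runs ω P' s c Q) : Runs ω (.branch t P P') s (t.cost + c) Q := by
  by_cases ht : t.Holds s
  · obtain ⟨s', u, h₁, h₂, h₃⟩ := h ht
    exact ⟨s', _, .branch_true ht h₁, by omega, h₃⟩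
  · obtain ⟨s', u, h₁, h₂, h₃⟩ := h' ht
    exact ⟨s', _, .branch_false ht h₁, by omega, h₃⟩

/-- The loop `for r = 0, 1, …, bound - 1 do body`. -/
def forLoop (r : ℕ) (bound : NatExpr) (body : Program) : Program :=
  .seq (.setNat r 0) (.loop (.natLt (.reg r) bound) (.seq body (.setNat r (.reg r + 1))))

theorem runs_forLoop {r : ℕ} {bound : NatExpr} {body : Program} {N : ℕ} (Inv : ℕ → State → Prop)
    (h_init : Inv 0 (s.setNat r 0)) (h_reg : ∀ i s, Inv i s → s.nat r = i)
    (h_bound : ∀ i s, Inv i s → bound.eval s = N)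
    (h_body : ∀ i s, i < N → Inv i s →
      Runs ω body s c (fun s' => s'.nat r = i ∧ Inv (i + 1) (s'.setNat r (i + 1)))) :
    Runs ω (forLoop r bound body) s ((N + 1) * (c + bound.cost + 8)) (Inv N) := by
  have key : ∀ k i s, i + k = N → Inv i s →
      Runs ω (.loop (.natLt (.reg r) bound) (.seq body (.setNat r (.reg r + 1)))) s
        ((k + 1) * (c + bound.cost + 6)) (Inv N) := by
    intro k
    induction k with
    | zero =>
      intro i s hi hs
      refine ⟨s, _, .loop_false ?_, ?_, ?_⟩
      · simp only [Test.Holds, NatExpr.eval_reg, h_reg i s hs, h_bound i s hs]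
        omega
      · simp only [Test.cost, NatExpr.cost]
        omega
      · have : i = N := by omega
        exact this ▸ hs
    | succ k ih =>
      intro i s hi hs
      obtain ⟨s₁, t₁, e₁, c₁, r₁, i₁⟩ := h_body i s (by omega) hs
      obtain ⟨s₂, t₂, e₂, c₂, i₂⟩ := ih (i + 1) (s₁.setNat r (i + 1)) (by omega) i₁
      have e : Exec ω (.setNat r (.reg r + 1)) s₁ (s₁.setNat r (i + 1)) 4 := by
        have := Exec.setNat (ω := ω) r (.reg r + 1) s₁
        simp [r₁] at this
        exact this
      refine ⟨s₂, _, .loop_true ?_ (.seq e₁ e) e₂, ?_, i₂⟩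
      · simp only [Test.Holds, NatExpr.eval_reg, h_reg i s hs, h_bound i s hs]
        omega
      · have : (k + 1 + 1) * (c + bound.cost + 6)
            = (k + 1) * (c + bound.cost + 6) + (c + bound.cost + 6) := by ring
        simp only [Test.cost, NatExpr.cost]
        omega
  obtain ⟨s', t, e, ht, hs'⟩ := key N 0 _ (by omega) h_init
  refine ⟨s', _, .seq (.setNat ..) e, ?_, hs'⟩
  have : (N + 1) * (c + bound.cost + 8) = (N + 1) * (c + bound.cost + 6) + (N + 1) * 2 := by ring
  have h2 : NatExpr.cost 0 = 1 := rfl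
  omega

/-- From `s` to `s'`, only the integer registers in `X` and the arrays in `K` have changed, and `d`
random numbers have been drawn. -/
structure Frame (X K : Finset ℕ) (d : ℕ) (s s' : State) : Prop where
  nat : ∀ x ∉ X, s'.nat x = s.nat x
  real : ∀ k ∉ K, s'.real k = s.real k
  drawn : s'.drawn = s.drawn + d

theorem Frame.refl (X K : Finset ℕ) (s : State) : Frame X K 0 s s :=
  ⟨fun _ _ => rfl, fun _ _ => rfl, rfl⟩

variable {X X' K K' : Finset ℕ} {d d' : ℕ} {s₁ s₂ s₃ : State}

theorem Frame.trans (h : Frame X K d s₁ s₂) (h' : Frame X' K' d' s₂ s₃) (hX : X' ⊆ X)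
    (hK : K' ⊆ K) : Frame X K (d + d') s₁ s₃ where
  nat x hx := by rw [h'.nat x (fun a => hx (hX a)), h.nat x hx]
  real k hk := by rw [h'.real k (fun a => hk (hK a)), h.real k hk]
  drawn := by rw [h'.drawn, h.drawn, add_assoc]

theorem Frame.mono (h : Frame X K d s₁ s₂) (hX : X ⊆ X') (hK : K ⊆ K') : Frame X' K' d s₁ s₂ where
  nat x hx := h.nat x (fun a => hx (hX a))
  real k hk := h.real k (fun a => hk (hK a))
  drawn := h.drawn

theorem Frame.setNat (h : Frame X K d s₁ s₂) {x : ℕ} (v : ℕ) (hx : x ∈ X) :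
    Frame X K d s₁ (s₂.setNat x v) where
  nat y hy := by
    rw [State.setNat_nat_of_ne _ _ (by rintro rfl; exact hy hx), h.nat y hy]
  real := h.real
  drawn := h.drawn

theorem Frame.setReal (h : Frame X K d s₁ s₂) {k : ℕ} (i : ℕ) (v : ℝ) (hk : k ∈ K) :
    Frame X K d s₁ (s₂.setReal k i v) where
  nat := h.nat
  real y hy := by
    rw [State.setReal_real_of_ne _ _ _ (by rintro rfl; exact hy hk), h.real y hy]
  drawn := h.drawn

end Rules

end RealRAM

/-! ### The mechanism as a program -/

namespace PrivatePacking

open RealRAM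

/-- The contents of the part of the memory that the program only reads once the number of rounds
has been computed: registers 0 to 2 and arrays 0 to 2. -/
structure Ctx {n m : ℕ} (p : Params n m) (D : Dataset n m) (s : State) : Prop where
  n_eq : s.nat 0 = n
  m_eq : s.nat 1 = m
  side_eq : s.nat 2 = p.side
  ε_eq : s.real 0 0 = p.ε
  δ_eq : s.real 0 1 = p.δ
  α_eq : s.real 0 2 = p.α
  b_eq : s.real 0 3 = p.b
  value_eq : ∀ i : Fin n, s.real 1 i = (D i).value
  demand_eq : ∀ (i : Fin n) (j : Fin m), s.real 2 (i * m + j) = (D i).demand j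

section Expressions

def logFactorExpr : RealExpr := 1 + .log ((.cast (.reg 1) + 1) / .read 0 1)

def sideExpr : RealExpr :=
  256 * logFactorExpr * .cast (.reg 1) / (.read 0 2 * .read 0 2)

def roundsExpr : RealExpr := .cast (.reg 2) * .cast (.reg 2)

/-- There is no square root among the operations; `√m` is `exp (ln m / 2)`. -/
def noiseScaleExpr : RealExpr :=
  2 * .cast (.reg 2) * .exp (.log (.cast (.reg 1)) / 2) * logFactorExpr / .read 0 0

def rateExpr : RealExpr := 64 * logFactorExpr / (.read 0 2 * .read 0 3 * roundsExpr)

def targetExpr : RealExpr := .read 0 3 - .read 0 2 * .read 0 3 / 4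

def capExpr : RealExpr := 4 * .cast (.reg 0) / .read 0 3

def baseExpr : RealExpr := .read 0 2 * .cast (.reg 0) / (4 * .cast (.reg 1) * .read 0 3)

/-- The log-odds of the random number in array 8. -/
def logitExpr : RealExpr := .log (.read 8 0 / (1 - .read 8 0))

end Expressions

section Programs

/-- Writes the normaliser of the weights into array 5. -/
def normalizerProgram : Program :=
  .seq (.setReal 5 0 1)
    (forLoop 4 (.reg 1) (.setReal 5 0 (.read 5 0 + .exp (rateExpr * .read 4 (.reg 4)))))

/-- Writes the price of the demand of the agent in register 5 into array 7. -/
def paymentProgram : Program :=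
  .seq (.setReal 7 0 0)
    (forLoop 4 (.reg 1) (.setReal 7 0 (.read 7 0 + .read 2 (.reg 5 * .reg 1 + .reg 4) *
      (baseExpr + capExpr * (.exp (rateExpr * .read 4 (.reg 4)) / .read 5 0)))))

/-- Adds the demand of the agent in register 5 to the load in array 6. -/
def addLoadProgram : Program :=
  forLoop 4 (.reg 1)
    (.setReal 6 (.reg 4) (.read 6 (.reg 4) + .read 2 (.reg 5 * .reg 1 + .reg 4)))

/-- The best response of the agent in register 5. -/
def agentProgram : Program :=
  .seq paymentProgram
    (.branch (.realLt (.read 7 0) (.read 1 (.reg 5)))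
      (.seq (.setReal 3 (.reg 5) (.read 3 (.reg 5) + 1 / roundsExpr)) addLoadProgram)
      (.setNat 4 0))

/-- Adds the noisy excess load to the state in array 4, and clears the load in array 6. -/
def updateProgram : Program :=
  forLoop 4 (.reg 1)
    (.seq (.sample 8 0)
      (.seq (.setReal 4 (.reg 4) (.read 4 (.reg 4) +
          (.read 6 (.reg 4) - targetExpr + noiseScaleExpr * logitExpr)))
        (.setReal 6 (.reg 4) 0)))

/-- One round: post prices, collect the best responses of all agents, and update the state. -/
def roundProgram : Program :=
  .seq normalizerProgram (.seq (forLoop 5 (.reg 0) agentProgram) updateProgram)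

/-- Rounds a real number up, by counting: the least natural number that is not below `sideExpr` is
written into register 2. -/
def sideProgram : Program :=
  .loop (.realLt (.cast (.reg 2)) sideExpr) (.setNat 2 (.reg 2 + 1))

/-- Array 3 holds the allocation, array 4 the cumulative noisy excess load, and array 6 the load of
the current round. -/
def mechanism : Program :=
  .seq sideProgram (forLoop 3 (.reg 2 * .reg 2) roundProgram)

end Programs

variable {n m : ℕ} {p : Params n m} {D : Dataset n m} {s s' : State} {ω : ℕ → unitInterval}

theorem Ctx.frame (h : Ctx p D s) {X K : Finset ℕ} {d : ℕ} (hf : Frame X K d s s')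
    (hX : ∀ x < 3, x ∉ X) (hK : ∀ k < 3, k ∉ K) : Ctx p D s' where
  n_eq := by rw [hf.nat 0 (hX 0 (by norm_num)), h.n_eq]
  m_eq := by rw [hf.nat 1 (hX 1 (by norm_num)), h.m_eq]
  side_eq := by rw [hf.nat 2 (hX 2 (by norm_num)), h.side_eq]
  ε_eq := by rw [hf.real 0 (hK 0 (by norm_num)), h.ε_eq]
  δ_eq := by rw [hf.real 0 (hK 0 (by norm_num)), h.δ_eq]
  α_eq := by rw [hf.real 0 (hK 0 (by norm_num)), h.α_eq]
  b_eq := by rw [hf.real 0 (hK 0 (by norm_num)), h.b_eq]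
  value_eq i := by rw [hf.real 1 (hK 1 (by norm_num)), h.value_eq]
  demand_eq i j := by rw [hf.real 2 (hK 2 (by norm_num)), h.demand_eq]

namespace Ctx

theorem eval_logFactor (h : Ctx p D s) : logFactorExpr.eval s = p.logFactor := by
  simp [logFactorExpr, Params.logFactor, h.m_eq, h.δ_eq]

theorem eval_rounds (h : Ctx p D s) : roundsExpr.eval s = p.rounds := by
  simp [roundsExpr, Params.rounds, h.side_eq]

theorem eval_noiseScale (hm : 1 ≤ m) (h : Ctx p D s) :
    noiseScaleExpr.eval s = p.noiseScale := by
  have hm' : (0 : ℝ) < m := by exact_mod_cast hm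
  simp [noiseScaleExpr, Params.noiseScale, h.eval_logFactor, h.m_eq, h.side_eq, h.ε_eq,
    Real.sqrt_eq_rpow, Real.rpow_def_of_pos hm', div_eq_mul_inv]

theorem eval_rate (h : Ctx p D s) : rateExpr.eval s = p.rate := by
  simp [rateExpr, Params.rate, h.eval_logFactor, h.eval_rounds, h.α_eq, h.b_eq]

theorem eval_target (h : Ctx p D s) : targetExpr.eval s = p.target := by
  simp [targetExpr, Params.target, h.α_eq, h.b_eq]

theorem eval_cap (h : Ctx p D s) : capExpr.eval s = p.cap := by
  simp [capExpr, Params.cap, h.n_eq, h.b_eq]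

theorem eval_base (h : Ctx p D s) : baseExpr.eval s = p.base := by
  simp [baseExpr, Params.base, h.n_eq, h.m_eq, h.b_eq, h.α_eq]

theorem runs_normalizer (h : Ctx p D s) {S : Fin m → ℝ} (hS : ∀ j : Fin m, s.real 4 j = S j) :
    Runs ω normalizerProgram s ((m + 1) * 100) (fun s' =>
      Frame {4} {5} 0 s s' ∧ s'.real 5 0 = p.normalizer S) := by
  have H := runs_forLoop (ω := ω) (r := 4) (bound := .reg 1) (N := m)
    (body := .setReal 5 0 (.read 5 0 + .exp (rateExpr * .read 4 (.reg 4))))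
    (s := s.setReal 5 0 1) (c := (rateExpr.cost + 12))
    (fun i s' => Frame {4} {5} 0 s s' ∧ s'.nat 4 = i ∧
      s'.real 5 0 = 1 + ∑ k ∈ Finset.range i, Real.exp (p.rate * s.real 4 k))
    ?_ (fun i s h => h.2.1) ?_ ?_
  · refine (Runs.seq (c := 4) ((runs_setReal ?_).mono (by decide) (fun _ => id))).mono
      (c := 4 + (m + 1) * ((rateExpr.cost + 12) + NatExpr.cost (.reg 1) + 8)) ?_ (fun _ => id)
    · refine Runs.mono (by simpa using H) le_rfl ?_
      rintro s' ⟨h₁, -, h₂⟩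
      refine ⟨h₁, ?_⟩
      rw [h₂, Finset.sum_range, Params.normalizer]
      simp [hS]
    · have : rateExpr.cost + 12 + NatExpr.cost (.reg 1) + 8 ≤ 96 := by decide
      nlinarith
  · refine ⟨((Frame.refl _ _ s).setReal _ _ (by simp)).setNat _ (by simp), by simp, by simp⟩
  · rintro i s' ⟨hf, -⟩
    exact (h.frame hf (by decide) (by decide)).m_eq
  · rintro i s' hi ⟨hf, h4, h5⟩
    have h' := h.frame hf (by decide) (by decide)
    refine (runs_setReal ?_).mono (by decide) (fun _ => id)
    refine ⟨by simpa using h4, (hf.setReal _ _ (by simp)).setNat _ (by simp), by simp, ?_⟩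
    simp [h'.eval_rate, h4, h5, Finset.sum_range_succ, hf.real 4 (by decide), add_assoc]

theorem runs_payment (h : Ctx p D s) {S : Fin m → ℝ} (hS : ∀ j : Fin m, s.real 4 j = S j)
    (hZ : s.real 5 0 = p.normalizer S) (i : Fin n) (hi : s.nat 5 = i) :
    Runs ω paymentProgram s ((m + 1) * 100) (fun s' =>
      Frame {4} {7} 0 s s' ∧ s'.real 7 0 = ∑ j, ((D i).demand j : ℝ) * p.price S j) := by
  have H := runs_forLoop (ω := ω) (r := 4) (bound := .reg 1) (N := m)
    (body := .setReal 7 0 (.read 7 0 + .read 2 (.reg 5 * .reg 1 + .reg 4) *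
      (baseExpr + capExpr * (.exp (rateExpr * .read 4 (.reg 4)) / .read 5 0))))
    (s := s.setReal 7 0 0) (c := (rateExpr.cost + baseExpr.cost + capExpr.cost + 22))
    (fun k s' => Frame {4} {7} 0 s s' ∧ s'.nat 4 = k ∧
      s'.real 7 0 = ∑ j ∈ Finset.range k, s.real 2 (i * m + j) *
        (p.base + p.cap * (Real.exp (p.rate * s.real 4 j) / p.normalizer S)))
    ?_ (fun i s h => h.2.1) ?_ ?_
  · refine (Runs.seq (c := 4) ((runs_setReal ?_).mono (by decide) (fun _ => id))).mono
      (c := 4 + (m + 1) * ((rateExpr.cost + baseExpr.cost + capExpr.cost + 22) +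
        NatExpr.cost (.reg 1) + 8)) ?_ (fun _ => id)
    · refine Runs.mono (by simpa using H) le_rfl ?_
      rintro s' ⟨h₁, -, h₂⟩
      refine ⟨h₁, ?_⟩
      rw [h₂, Finset.sum_range]
      simp [hS, h.demand_eq, Params.price, Params.weight]
    · have : rateExpr.cost + baseExpr.cost + capExpr.cost + 22 + NatExpr.cost (.reg 1) + 8 ≤ 96 := by
        decide
      nlinarith
  · refine ⟨((Frame.refl _ _ s).setReal _ _ (by simp)).setNat _ (by simp), by simp, by simp⟩
  · rintro i s' ⟨hf, -⟩
    exact (h.frame hf (by decide) (by decide)).m_eq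
  · rintro k s' hk ⟨hf, h4, h7⟩
    have h' := h.frame hf (by decide) (by decide)
    refine (runs_setReal ?_).mono (by decide) (fun _ => id)
    refine ⟨by simpa using h4, (hf.setReal _ _ (by simp)).setNat _ (by simp), by simp, ?_⟩
    simp [h'.eval_rate, h'.eval_base, h'.eval_cap, h4, h7, h'.m_eq, Finset.sum_range_succ,
      hf.real 4 (by decide), hf.real 5 (by decide), hf.real 2 (by decide), hf.nat 5 (by decide),
      hi, hZ]

theorem runs_addLoad (h : Ctx p D s) (i : Fin n) (hi : s.nat 5 = i) :
    Runs ω addLoadProgram s ((m + 1) * 100) (fun s' =>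
      Frame {4} {6} 0 s s' ∧ ∀ j : Fin m, s'.real 6 j = s.real 6 j + (D i).demand j) := by
  have H := runs_forLoop (ω := ω) (r := 4) (bound := .reg 1) (N := m)
    (body := .setReal 6 (.reg 4) (.read 6 (.reg 4) + .read 2 (.reg 5 * .reg 1 + .reg 4)))
    (s := s) (c := 50)
    (fun k s' => Frame {4} {6} 0 s s' ∧ s'.nat 4 = k ∧
      ∀ j : Fin m, s'.real 6 j = s.real 6 j + if (j : ℕ) < k then ((D i).demand j : ℝ) else 0)
    ?_ (fun i s h => h.2.1) ?_ ?_
  · refine H.mono ?_ ?_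
    · gcongr
      decide
    · rintro s' ⟨h₁, -, h₂⟩
      exact ⟨h₁, fun j => by rw [h₂, if_pos j.2]⟩
  · refine ⟨(Frame.refl _ _ s).setNat _ (by simp), by simp, by simp⟩
  · rintro i s' ⟨hf, -⟩
    exact (h.frame hf (by decide) (by decide)).m_eq
  · rintro k s' hk ⟨hf, h4, h6⟩
    have h' := h.frame hf (by decide) (by decide)
    refine (runs_setReal ?_).mono (by decide) (fun _ => id)
    refine ⟨by simpa using h4, (hf.setReal _ _ (by simp)).setNat _ (by simp), by simp, ?_⟩
    intro j
    have hd := h'.demand_eq i ⟨k, hk⟩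
    simp only [] at hd
    by_cases hjk : (j : ℕ) = k
    · have hj : j = ⟨k, hk⟩ := Fin.ext hjk
      subst hj
      have := h6 ⟨k, hk⟩
      simp at this
      simp [h4, h'.m_eq, hf.nat 5 (by decide), hi, hd, this]
    · have : (j : ℕ) < k + 1 ↔ (j : ℕ) < k := by omega
      simp [h4, Function.update_of_ne hjk, h6, this]

theorem runs_agent (h : Ctx p D s) {S : Fin m → ℝ} (hS : ∀ j : Fin m, s.real 4 j = S j)
    (hZ : s.real 5 0 = p.normalizer S) (i : Fin n) (hi : s.nat 5 = i) :
    Runs ω agentProgram s ((m + 1) * 300) (fun s' =>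
      Frame {4} {3, 6, 7} 0 s s' ∧
      (∀ l : Fin n, s'.real 3 l = s.real 3 l + if l = i then p.buys S (D i) / p.rounds else 0) ∧
      ∀ j : Fin m, s'.real 6 j = s.real 6 j + (D i).demand j * p.buys S (D i)) := by
  refine (Runs.seq (c' := (m + 1) * 100 + 30) ((h.runs_payment hS hZ i hi).mono le_rfl ?_)).mono
    (by nlinarith) (fun _ => id)
  rintro s' ⟨hf, h7⟩
  have h' := h.frame hf (by decide) (by decide)
  have hi' : s'.nat 5 = i := by rw [hf.nat 5 (by decide), hi]
  refine (runs_branch (c := 20 + (m + 1) * 100) ?_ ?_).mono ?_ (fun _ => id)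
  · intro ht
    simp only [Test.Holds, RealExpr.eval_read, NatExpr.eval_ofNat, NatExpr.eval_reg, h7, hi',
      h'.value_eq] at ht
    refine Runs.seq (c := 20) ((runs_setReal ?_).mono (by decide) (fun _ => id))
    refine (runs_addLoad (p := p) (D := D)
      (h'.frame ((Frame.refl {3} {3} s').setReal _ _ (by decide)) (by decide) (by decide)) i
      (by simpa using hi')).mono le_rfl ?_
    rintro s'' ⟨hf', h6⟩
    refine ⟨(hf.mono (by decide) (by decide)).trans (((Frame.refl {4} {3, 6, 7} s').setReal _ _
      (by decide)).trans (hf'.mono (by decide) (by decide)) subset_rfl subset_rfl) subset_rfl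
      subset_rfl, ?_, ?_⟩
    · intro l
      rw [hf'.real 3 (by decide)]
      by_cases hl : l = i
      · subst hl
        simp [hi', h'.eval_rounds, hf.real 3 (by decide), Params.buys, ht]
      · have : (l : ℕ) ≠ i := fun e => hl (Fin.ext e)
        simp [hi', Function.update_of_ne this, hl, hf.real 3 (by decide)]
    · intro j
      rw [h6 j]
      simp [State.setReal_real_of_ne, hf.real 6 (by decide), Params.buys, ht]
  · intro ht
    simp only [Test.Holds, RealExpr.eval_read, NatExpr.eval_ofNat, NatExpr.eval_reg, h7, hi',
      h'.value_eq] at ht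
    refine (runs_setNat ?_).mono (c := 2) (by nlinarith) (fun _ => id)
    refine ⟨(hf.mono (by decide) (by decide)).setNat _ (by decide), ?_, ?_⟩
    · intro l
      simp [hf.real 3 (by decide), Params.buys, ht]
    · intro j
      simp [hf.real 6 (by decide), Params.buys, ht]
  · have : Test.cost (.realLt (.read 7 0) (.read 1 (.reg 5))) ≤ 10 := by decide
    omega

theorem runs_agents (h : Ctx p D s) {S : Fin m → ℝ} (hS : ∀ j : Fin m, s.real 4 j = S j)
    (hZ : s.real 5 0 = p.normalizer S) :
    Runs ω (forLoop 5 (.reg 0) agentProgram) s ((n + 1) * ((m + 1) * 310)) (fun s' =>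
      Frame {4, 5} {3, 6, 7} 0 s s' ∧
      (∀ i : Fin n, s'.real 3 i = s.real 3 i + p.buys S (D i) / p.rounds) ∧
      ∀ j : Fin m, s'.real 6 j = s.real 6 j + p.load D S j) := by
  have H := runs_forLoop (ω := ω) (r := 5) (bound := .reg 0) (N := n) (body := agentProgram)
    (s := s) (c := (m + 1) * 300)
    (fun k s' => Frame {4, 5} {3, 6, 7} 0 s s' ∧ s'.nat 5 = k ∧
      (∀ i : Fin n, s'.real 3 i = s.real 3 i +
        if (i : ℕ) < k then p.buys S (D i) / p.rounds else 0) ∧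
      ∀ j : Fin m, s'.real 6 j = s.real 6 j + ∑ i ∈ Finset.range k,
        if hi : i < n then (D ⟨i, hi⟩).demand j * p.buys S (D ⟨i, hi⟩) else 0)
    ?_ (fun i s h => h.2.1) ?_ ?_
  · refine H.mono ?_ ?_
    · gcongr
      have : NatExpr.cost (.reg 0) = 1 := rfl
      omega
    · rintro s' ⟨h₁, -, h₂, h₃⟩
      refine ⟨h₁, fun i => by rw [h₂, if_pos i.2], fun j => ?_⟩
      rw [h₃, Finset.sum_range]
      simp [Params.load]
  · refine ⟨(Frame.refl _ _ s).setNat _ (by simp), by simp, by simp, by simp⟩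
  · rintro i s' ⟨hf, -⟩
    exact (h.frame hf (by decide) (by decide)).n_eq
  · rintro k s' hk ⟨hf, h5, h3, h6⟩
    have h' := h.frame hf (by decide) (by decide)
    refine (h'.runs_agent (S := S) (i := ⟨k, hk⟩) (by simpa [hf.real 4 (by decide)] using hS)
      (by simpa [hf.real 5 (by decide)] using hZ) h5).mono le_rfl ?_
    rintro s'' ⟨hf', h3', h6'⟩
    refine ⟨by rw [hf'.nat 5 (by decide), h5],
      (hf.trans hf' (by decide) (by decide)).setNat _ (by decide), by simp, ?_, ?_⟩
    · intro i
      rw [State.setNat_real, h3', h3]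
      by_cases hik : (i : ℕ) = k
      · have hi : i = ⟨k, hk⟩ := Fin.ext hik
        subst hi
        simp
      · have h₁ : i ≠ ⟨k, hk⟩ := fun e => hik (by rw [e])
        have h₂ : (i : ℕ) < k + 1 ↔ (i : ℕ) < k := by omega
        simp [h₁, h₂]
    · intro j
      rw [State.setNat_real, h6', h6, Finset.sum_range_succ, dif_pos hk, add_assoc]

theorem runs_update (hm : 1 ≤ m) (h : Ctx p D s) :
    Runs ω updateProgram s ((m + 1) * 150) (fun s' =>
      Frame {4} {4, 6, 8} m s s' ∧
      ∀ j : Fin m, s'.real 4 j = s.real 4 j +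
        (s.real 6 j - p.target + p.noiseScale * logit (ω (s.drawn + j))) ∧ s'.real 6 j = 0) := by
  have H := runs_forLoop (ω := ω) (r := 4) (bound := .reg 1) (N := m)
    (body := .seq (.sample 8 0)
      (.seq (.setReal 4 (.reg 4) (.read 4 (.reg 4) +
          (.read 6 (.reg 4) - targetExpr + noiseScaleExpr * logitExpr)))
        (.setReal 6 (.reg 4) 0)))
    (s := s) (c := 2 + (80 + 4))
    (fun k s' => Frame {4} {4, 6, 8} k s s' ∧ s'.nat 4 = k ∧
      ∀ j : Fin m, (s'.real 4 j = if (j : ℕ) < k then s.real 4 j +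
        (s.real 6 j - p.target + p.noiseScale * logit (ω (s.drawn + j))) else s.real 4 j) ∧
        (s'.real 6 j = if (j : ℕ) < k then 0 else s.real 6 j))
    ?_ (fun i s h => h.2.1) ?_ ?_
  · refine H.mono ?_ ?_
    · gcongr
      decide
    · rintro s' ⟨h₁, -, h₂⟩
      refine ⟨h₁, fun j => ?_⟩
      simpa using h₂ j
  · refine ⟨(Frame.refl _ _ s).setNat _ (by simp), by simp, by simp⟩
  · rintro i s' ⟨hf, -⟩
    exact (h.frame hf (by decide) (by decide)).m_eq
  · rintro k s' hk ⟨hf, h4, h46⟩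
    have h' := h.frame hf (by decide) (by decide)
    refine Runs.seq ((runs_sample ?_).mono (by decide) (fun _ => id))
    refine Runs.seq ((runs_setReal ?_).mono (by decide) (fun _ => id))
    refine (runs_setReal ?_).mono (by decide) (fun _ => id)
    set s₁ : State := { s'.setReal 8 (NatExpr.eval s' 0) (ω s'.drawn : ℝ) with
      drawn := s'.drawn + 1 } with hs₁
    have hf₁ : Frame {4} {4, 6, 8} (k + 1) s s₁ :=
      ⟨hf.nat, fun l hl => (hf.setReal (k := 8) _ _ (by decide)).real l hl, by
        simp [hs₁, hf.drawn, add_assoc]⟩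
    have hc₁ : Ctx p D s₁ := h.frame hf₁ (by decide) (by decide)
    have n4 : s₁.nat 4 = k := by simpa [hs₁] using h4
    have r8 : s₁.real 8 0 = ω (s.drawn + k) := by simp [hs₁, hf.drawn]
    have r4 : s₁.real 4 = s'.real 4 := by simp [hs₁, State.setReal_real_of_ne]
    have r6 : s₁.real 6 = s'.real 6 := by simp [hs₁, State.setReal_real_of_ne]
    refine ⟨by simpa using n4, ((hf₁.setReal _ _ (by decide)).setReal _ _ (by decide)).setNat _
      (by decide), by simp, ?_⟩
    intro j
    simp only [State.setNat_real, State.setReal_real_same, State.setReal_nat, NatExpr.eval_reg, n4,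
      State.setReal_real_of_ne _ _ _ (show 4 ≠ 6 by decide),
      State.setReal_real_of_ne _ _ _ (show 6 ≠ 4 by decide), r4, r6]
    by_cases hjk : (j : ℕ) = k
    · have hj : j = ⟨k, hk⟩ := Fin.ext hjk
      subst hj
      obtain ⟨e4, e6⟩ := h46 ⟨k, hk⟩
      simp at e4 e6
      simp [n4, r4, r6, e4, e6, hc₁.eval_target, hc₁.eval_noiseScale hm, logitExpr, r8, logit]
    · have : (j : ℕ) < k + 1 ↔ (j : ℕ) < k := by omega
      obtain ⟨e4, e6⟩ := h46 j
      simp only [Function.update_of_ne hjk, this]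
      exact ⟨e4, e6⟩

theorem runs_round (hm : 1 ≤ m) (h : Ctx p D s) {S : Fin m → ℝ}
    (hS : ∀ j : Fin m, s.real 4 j = S j) (h6 : ∀ j : Fin m, s.real 6 j = 0) :
    Runs ω roundProgram s ((n + 1) * ((m + 1) * 560)) (fun s' =>
      Frame {4, 5} {3, 4, 5, 6, 7, 8} m s s' ∧
      (∀ i : Fin n, s'.real 3 i = s.real 3 i + p.buys S (D i) / p.rounds) ∧
      ∀ j : Fin m, s'.real 4 j = S j + (p.load D S j - p.target +
        p.noiseScale * logit (ω (s.drawn + j))) ∧ s'.real 6 j = 0) := by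
  refine (Runs.seq (c' := (n + 1) * ((m + 1) * 310) + (m + 1) * 150)
    ((h.runs_normalizer hS).mono le_rfl ?_)).mono (by nlinarith) (fun _ => id)
  rintro s₁ ⟨f₁, h5⟩
  have h₁ := h.frame f₁ (by decide) (by decide)
  refine Runs.seq ((h₁.runs_agents (S := S) (by simpa [f₁.real 4 (by decide)] using hS) h5).mono
    le_rfl ?_)
  rintro s₂ ⟨f₂, h3, h6'⟩
  have h₂ := h₁.frame f₂ (by decide) (by decide)
  refine (h₂.runs_update hm).mono le_rfl ?_
  rintro s₃ ⟨f₃, h46⟩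
  refine ⟨?_, ?_, ?_⟩
  · have := ((f₁.mono (X' := {4, 5}) (K' := {3, 4, 5, 6, 7, 8}) (by decide) (by decide)).trans f₂
      (by decide) (by decide)).trans f₃ (by decide) (by decide)
    simpa using this
  · intro i
    rw [f₃.real 3 (by decide), h3, f₁.real 3 (by decide)]
  · intro j
    refine ⟨?_, (h46 j).2⟩
    rw [(h46 j).1, h6', f₂.real 4 (by decide), f₁.real 4 (by decide), f₁.real 6 (by decide), h6, hS,
      f₂.drawn, f₁.drawn]
    simp

end Ctx

theorem runs_side (hs : ∀ k : ℕ, sideExpr.eval (s.setNat 2 k) =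
    256 * p.logFactor * m / (p.α * p.α)) (h2 : s.nat 2 = 0) :
    Runs ω sideProgram s ((p.side + 1) * 40) (fun s' => s' = s.setNat 2 p.side) := by
  have key : ∀ d k, k + d = p.side →
      Runs ω sideProgram (s.setNat 2 k) ((d + 1) * 40) (fun s' => s' = s.setNat 2 p.side) := by
    have hc : Test.cost (.realLt (.cast (.reg 2)) sideExpr) ≤ 36 := by decide
    intro d
    induction d with
    | zero =>
      intro k hk
      refine ⟨_, _, .loop_false ?_, by omega, by rw [← hk, add_zero]⟩
      simp only [Test.Holds, RealExpr.eval_cast, NatExpr.eval_reg, State.setNat_nat_same, hs,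
        not_lt]
      exact Nat.ceil_le.1 (show p.side ≤ k by omega)
    | succ d ih =>
      intro k hk
      obtain ⟨s', t, e, ht, hq⟩ := ih (k + 1) (by omega)
      have hup : (s.setNat 2 k).setNat 2 (k + 1) = s.setNat 2 (k + 1) := by
        simp [State.setNat]
      have e' : Exec ω (.setNat 2 (.reg 2 + 1)) (s.setNat 2 k) (s.setNat 2 (k + 1)) 4 := by
        have := Exec.setNat (ω := ω) 2 (.reg 2 + 1) (s.setNat 2 k)
        simp [hup] at this
        exact this
      refine ⟨s', _, .loop_true ?_ e' e, by omega, hq⟩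
      simp only [Test.Holds, RealExpr.eval_cast, NatExpr.eval_reg, State.setNat_nat_same, hs]
      exact Nat.lt_ceil.1 (show k < p.side by omega)
  have h0 : s.setNat 2 0 = s := by
    rw [State.setNat, ← h2, Function.update_eq_self]
  have := key p.side 0 (by omega)
  rwa [h0] at this

theorem ctx_initial : Ctx p D ((initial p.ε p.δ p.α p.b D).setNat 2 p.side) where
  n_eq := rfl
  m_eq := rfl
  side_eq := by simp
  ε_eq := by simp [initial]
  δ_eq := by simp [initial]
  α_eq := by simp [initial]
  b_eq := by simp [initial]
  value_eq i := by simp [initial]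
  demand_eq i j := by
    have hlt : (i : ℕ) * m + j < n * m := by
      calc (i : ℕ) * m + j < i * m + m := by omega
        _ = (i + 1) * m := by ring
        _ ≤ n * m := Nat.mul_le_mul_right m i.2
    have : (⟨i * m + j, hlt⟩ : Fin (n * m)) = finProdFinEquiv (i, j) := by
      ext
      simp [finProdFinEquiv]
      ring
    simp [initial, hlt, this, -finProdFinEquiv_symm_apply]

/-- The program computes `output`, in a number of steps that is linear in the number of agents. -/
theorem exec_mechanism (hm : 1 ≤ m) (p : Params n m) (D : Dataset n m) (ω : ℕ → unitInterval) :
    ∃ t, Returns mechanism p.ε p.δ p.α p.b D ω (output p D ω) t ∧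
      t ≤ (p.side * p.side + 1) * ((n + 1) * ((m + 1) * 620)) := by
  have hc := ctx_initial (p := p) (D := D)
  set s := initial p.ε p.δ p.α p.b D with hs
  have hside : Runs ω sideProgram s ((p.side + 1) * 40) (fun s' => s' = s.setNat 2 p.side) := by
    refine runs_side (fun k => ?_) rfl
    simp [sideExpr, logFactorExpr, Params.logFactor, hs, initial, State.setNat_nat_of_ne]
  have H := runs_forLoop (ω := ω) (r := 3) (bound := .reg 2 * .reg 2) (N := p.side * p.side)
    (body := roundProgram) (s := s.setNat 2 p.side) (c := (n + 1) * ((m + 1) * 560))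
    (fun t s' => Ctx p D s' ∧ s'.nat 3 = t ∧ s'.drawn = t * m ∧
      (∀ j : Fin m, s'.real 4 j = dualState p D ω t j) ∧ (∀ j : Fin m, s'.real 6 j = 0) ∧
      ∀ i : Fin n, s'.real 3 i = ∑ r ∈ Finset.range t, p.buys (dualState p D ω r) (D i) / p.rounds)
    ?_ (fun i s h => h.2.1) ?_ ?_
  · have R : Runs ω mechanism s ((p.side + 1) * 40 + (p.side * p.side + 1) *
        ((n + 1) * ((m + 1) * 560) + NatExpr.cost (.reg 2 * .reg 2) + 8)) _ :=
      Runs.seq (hside.mono le_rfl (fun s' e => by rw [e]; exact H))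
    obtain ⟨s', t, e, ht, -, -, -, -, -, h3⟩ := R
    refine ⟨t, ⟨s', e, funext fun i => h3 i⟩, ht.trans ?_⟩
    have h3 : NatExpr.cost (.reg 2 * .reg 2) = 3 := rfl
    rw [h3]
    have h1 : p.side ≤ p.side * p.side := Nat.le_mul_self _
    have h2 : 1 ≤ (n + 1) * (m + 1) := Nat.mul_pos (by omega) (by omega)
    have h4 : p.side * p.side + 1 ≤ (p.side * p.side + 1) * ((n + 1) * (m + 1)) :=
      Nat.le_mul_of_pos_right _ h2
    have h5 : (p.side * p.side + 1) * ((n + 1) * ((m + 1) * 560) + 3 + 8)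
      = 560 * ((p.side * p.side + 1) * ((n + 1) * (m + 1))) + 11 * (p.side * p.side + 1) := by ring
    have h6 : (p.side * p.side + 1) * ((n + 1) * ((m + 1) * 620))
      = 620 * ((p.side * p.side + 1) * ((n + 1) * (m + 1))) := by ring
    omega
  · refine ⟨hc.frame ((Frame.refl {3} ∅ _).setNat _ (by simp)) (by decide) (by decide), by simp,
      by simp [hs, initial], ?_, ?_, ?_⟩ <;> simp [hs, initial, dualState]
  · rintro i s' ⟨h, -⟩
    simp [h.side_eq]
  · rintro t s' ht ⟨h, h3, hd, h4, h6, h3'⟩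
    refine (h.runs_round hm h4 h6).mono le_rfl ?_
    rintro s'' ⟨hf, g3, g46⟩
    refine ⟨by rw [hf.nat 3 (by decide), h3],
      h.frame (hf.mono (X' := {3, 4, 5}) (by decide) subset_rfl |>.setNat _ (by decide)) (by decide)
      (by decide), by simp, ?_, ?_, ?_, ?_⟩
    · simp [hf.drawn, hd]
      ring
    · intro j
      simp [(g46 j).1, dualState, hd]
    · intro j
      simp [(g46 j).2]
    · intro i
      simp [g3, h3', Finset.sum_range_succ]

end PrivatePacking

/-! ### Uniform random numbers and logistic noise -/

namespace RealRAM

instance : IsProbabilityMeasure coins := by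
  unfold coins
  infer_instance

/-- Replacing one of the random numbers by a fresh one does not change their joint law. -/
theorem measurePreserving_update (k : ℕ) :
    MeasurePreserving (fun x : (ℕ → unitInterval) × unitInterval => Function.update x.1 k x.2)
      (coins.prod volume) coins := by
  have hmeas : Measurable
      (fun x : (ℕ → unitInterval) × unitInterval => Function.update x.1 k x.2) := by
    refine measurable_pi_lambda _ fun i => ?_
    by_cases h : i = k
    · subst h
      simpa using measurable_snd
    · simp only [Function.update_of_ne h]
      fun_prop
  refine ⟨hmeas, ?_⟩
  refine Measure.eq_infinitePi (μ := fun _ : ℕ => (volume : Measure unitInterval)) fun s t ht => ?_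
  have hpi : MeasurableSet (Set.pi (s : Set ℕ) t) := MeasurableSet.pi s.countable_toSet fun i _ => ht i
  rw [Measure.map_apply hmeas hpi]
  have hpre : (fun x : (ℕ → unitInterval) × unitInterval => Function.update x.1 k x.2) ⁻¹'
      Set.pi (s : Set ℕ) t
      = Set.pi ((s.erase k : Finset ℕ) : Set ℕ) t ×ˢ (if k ∈ s then t k else Set.univ) := by
    ext ⟨ω, u⟩
    simp only [Set.mem_preimage, Set.mem_pi, Set.mem_prod, Finset.coe_erase, Set.mem_sdiff,
      Set.mem_singleton_iff, Finset.mem_coe]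
    constructor
    · intro h
      refine ⟨fun i hi => by simpa [Function.update_of_ne hi.2] using h i hi.1, ?_⟩
      split_ifs with hk
      · simpa using h k hk
      · trivial
    · rintro ⟨h₁, h₂⟩ i hi
      by_cases hik : i = k
      · subst hik
        simpa [hi] using h₂
      · simpa [Function.update_of_ne hik] using h₁ i ⟨hi, hik⟩
  rw [hpre, Measure.prod_prod, coins, Measure.infinitePi_pi _ (fun i _ => ht i)]
  split_ifs with hk
  · rw [mul_comm, Finset.mul_prod_erase s (fun i => volume (t i)) hk]
  · rw [Finset.erase_eq_of_notMem hk]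
    simp

theorem lintegral_coins_update (k : ℕ) {f : (ℕ → unitInterval) → ENNReal} (hf : Measurable f) :
    ∫⁻ ω, f ω ∂coins = ∫⁻ ω, (∫⁻ u, f (Function.update ω k u)) ∂coins := by
  have h := measurePreserving_update k
  rw [← h.lintegral_comp hf]
  exact lintegral_prod _ (hf.comp h.measurable).aemeasurable

end RealRAM

namespace PrivatePacking

open RealRAM

theorem measurable_logit : Measurable logit := by
  unfold logit
  fun_prop

theorem logit_symm (u : unitInterval) : logit (unitInterval.symm u) = -logit u := by
  simp only [logit, unitInterval.coe_symm_eq, sub_sub_cancel]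
  rw [← Real.log_inv, inv_div]

theorem logit_sigmoid {u : unitInterval} {x : ℝ} (h : (u : ℝ) = Real.sigmoid x) : logit u = x := by
  have h1 := Real.sigmoid_pos x
  have h2 := Real.sigmoid_mul_rexp_neg x
  rw [logit, h, ← Real.sigmoid_neg, ← h2, div_mul_cancel_left₀ h1.ne', Real.exp_neg, inv_inv,
    Real.log_exp]

/-- The density of the standard logistic law. -/
noncomputable def logisticDensity (x : ℝ) : ℝ := (2 + Real.exp x + Real.exp (-x))⁻¹

theorem logisticDensity_pos (x : ℝ) : 0 < logisticDensity x := by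
  unfold logisticDensity
  positivity

theorem measurable_logisticDensity : Measurable logisticDensity := by
  unfold logisticDensity
  fun_prop

theorem sigmoid_mul_one_sub (x : ℝ) :
    Real.sigmoid x * (1 - Real.sigmoid x) = logisticDensity x := by
  rw [← Real.sigmoid_neg, Real.sigmoid_def, Real.sigmoid_def, neg_neg, logisticDensity, ← mul_inv]
  congr 1
  have : Real.exp (-x) * Real.exp x = 1 := by rw [← Real.exp_add]; simp
  linear_combination this

theorem lintegral_unitInterval (φ : ℝ → ENNReal) (hφ : Measurable φ) :
    ∫⁻ u : unitInterval, φ u = ∫⁻ x in Set.Ioo (0 : ℝ) 1, φ x := by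
  rw [unitInterval.measurePreserving_coe.lintegral_comp hφ]
  exact setLIntegral_congr Ioo_ae_eq_Icc.symm

/-- The log-odds of a uniform random number follow the logistic law. -/
theorem lintegral_logit {φ : ℝ → ENNReal} (hφ : Measurable φ) :
    ∫⁻ u, φ (logit u) = ∫⁻ x, ENNReal.ofReal (logisticDensity x) * φ x := by
  have h1 : ∫⁻ u, φ (logit u) =
      ∫⁻ x in Set.Ioo (0 : ℝ) 1, φ (Real.log (x / (1 - x))) := by
    rw [← lintegral_unitInterval (fun x => φ (Real.log (x / (1 - x)))) (by fun_prop)]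
    rfl
  rw [h1, ← Real.range_sigmoid, ← Set.image_univ,
    lintegral_image_eq_lintegral_abs_deriv_mul MeasurableSet.univ
      (fun x _ => (Real.hasDerivAt_sigmoid x).hasDerivWithinAt) Real.sigmoid_injective.injOn,
    setLIntegral_univ]
  refine lintegral_congr fun x => ?_
  have h2 : Real.log (Real.sigmoid x / (1 - Real.sigmoid x)) = x :=
    logit_sigmoid (u := ⟨Real.sigmoid x, Real.sigmoid_nonneg x, Real.sigmoid_le_one x⟩) rfl
  rw [h2, sigmoid_mul_one_sub, abs_of_pos (logisticDensity_pos x)]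

theorem logisticDensity_add_le {s a : ℝ} (hs : |s| ≤ a) (x : ℝ) :
    logisticDensity (x + s) ≤ Real.exp a * logisticDensity x := by
  obtain ⟨h₁, h₂⟩ := abs_le.1 hs
  unfold logisticDensity
  rw [inv_le_iff_one_le_mul₀ (by positivity), mul_assoc, mul_comm, mul_assoc, inv_mul_eq_div,
    le_div_iff₀ (by positivity), one_mul]
  have e1 : Real.exp x ≤ Real.exp (x + s) * Real.exp a := by
    rw [← Real.exp_add]; exact Real.exp_le_exp.2 (by linarith)
  have e2 : Real.exp (-x) ≤ Real.exp (-(x + s)) * Real.exp a := by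
    rw [← Real.exp_add]; exact Real.exp_le_exp.2 (by linarith)
  have e3 : 1 ≤ Real.exp a := Real.one_le_exp (by linarith)
  linarith

/-- The likelihood ratio between the logistic law and its translate. -/
noncomputable def logisticRatio (s x : ℝ) : ℝ := logisticDensity (x + s) / logisticDensity x

theorem measurable_logisticRatio (s : ℝ) : Measurable (logisticRatio s) := by
  unfold logisticRatio
  have := measurable_logisticDensity
  fun_prop

theorem logisticRatio_pos (s x : ℝ) : 0 < logisticRatio s x :=
  div_pos (logisticDensity_pos _) (logisticDensity_pos _)

theorem abs_log_logisticRatio_le {s a : ℝ} (hs : |s| ≤ a) (x : ℝ) :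
    |Real.log (logisticRatio s x)| ≤ a := by
  have hx := logisticDensity_pos x
  rw [abs_le]
  constructor
  · rw [Real.le_log_iff_exp_le (logisticRatio_pos s x), logisticRatio, le_div_iff₀ hx]
    have h := logisticDensity_add_le (s := -s) (by simpa using hs) (x + s)
    rw [add_neg_cancel_right] at h
    calc Real.exp (-a) * logisticDensity x
        ≤ Real.exp (-a) * (Real.exp a * logisticDensity (x + s)) := by gcongr
      _ = logisticDensity (x + s) := by rw [← mul_assoc, ← Real.exp_add]; simp
  · rw [Real.log_le_iff_le_exp (logisticRatio_pos s x), logisticRatio, div_le_iff₀ hx]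
    exact logisticDensity_add_le hs x

theorem lintegral_logit_translate {φ : ℝ → ENNReal} (hφ : Measurable φ) (s : ℝ) :
    ∫⁻ u, φ (logit u - s) = ∫⁻ u, φ (logit u) * ENNReal.ofReal (logisticRatio s (logit u)) := by
  have hr := measurable_logisticRatio s
  rw [lintegral_logit (φ := fun x => φ (x - s)) (by fun_prop),
    lintegral_logit (φ := fun x => φ x * ENNReal.ofReal (logisticRatio s x)) (by fun_prop),
    ← lintegral_add_right_eq_self _ s]
  refine lintegral_congr fun x => ?_
  rw [add_sub_cancel_right, mul_comm (φ x), ← mul_assoc,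
    ← ENNReal.ofReal_mul (logisticDensity_pos x).le, logisticRatio,
    mul_div_cancel₀ _ (logisticDensity_pos x).ne']

theorem lintegral_logisticRatio (s : ℝ) :
    ∫⁻ u, ENNReal.ofReal (logisticRatio s (logit u)) = 1 := by
  have := lintegral_logit_translate (φ := fun _ => 1) measurable_const s
  simpa using this.symm

/-- The moments of the likelihood ratio `r` of two translates of the logistic law. As
`log r` lies in `[-a, a]` and `log r ≤ r - 1`, convexity bounds `r ^ q` by an affine function of
`r`, and the mean of `r` is `1`. -/
theorem lintegral_logisticRatio_rpow_le {s a q : ℝ} (ha : 0 < a) (hs : |s| ≤ a) (hq : 0 < q) :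
    ∫⁻ u, ENNReal.ofReal (logisticRatio s (logit u)) ^ q ≤
      ENNReal.ofReal (Real.exp ((q * a) ^ 2 / 2)) := by
  set κ : ℝ := Real.sinh (q * a) / a with hκ
  have hsinh : 0 ≤ Real.sinh (q * a) := Real.sinh_nonneg_iff.2 (by positivity)
  have hκ0 : 0 ≤ κ := div_nonneg hsinh ha.le
  have hr := measurable_logisticRatio s
  have hl := measurable_logit
  have pt : ∀ x, logisticRatio s x ^ q + κ ≤ Real.cosh (q * a) + κ * logisticRatio s x := by
    intro x
    have hp := logisticRatio_pos s x
    have h1 := abs_log_logisticRatio_le hs x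
    have h2 : |Real.log (logisticRatio s x) / a| ≤ 1 := by
      rw [abs_div, abs_of_pos ha]
      exact (div_le_one ha).2 h1
    have h3 := Real.exp_mul_le_cosh_add_mul_sinh h2 (q * a)
    have h4 : Real.log (logisticRatio s x) / a * (q * a) = Real.log (logisticRatio s x) * q := by
      field_simp
    rw [h4, ← Real.rpow_def_of_pos hp] at h3
    have h5 : Real.log (logisticRatio s x) / a * Real.sinh (q * a)
        ≤ κ * (logisticRatio s x - 1) := by
      have h6 := Real.log_le_sub_one_of_pos hp
      calc Real.log (logisticRatio s x) / a * Real.sinh (q * a)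
          = κ * Real.log (logisticRatio s x) := by rw [hκ]; ring
        _ ≤ _ := by gcongr
    linarith
  have int : ∫⁻ u, (ENNReal.ofReal (logisticRatio s (logit u)) ^ q + ENNReal.ofReal κ) ≤
      ∫⁻ u, (ENNReal.ofReal (Real.cosh (q * a)) +
        ENNReal.ofReal κ * ENNReal.ofReal (logisticRatio s (logit u))) := by
    refine lintegral_mono fun u => ?_
    have hp := logisticRatio_pos s (logit u)
    dsimp only
    rw [ENNReal.ofReal_rpow_of_pos hp, ← ENNReal.ofReal_mul hκ0,
      ← ENNReal.ofReal_add (by positivity) hκ0,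
      ← ENNReal.ofReal_add (Real.cosh_pos _).le (by positivity)]
    exact ENNReal.ofReal_le_ofReal (pt _)
  rw [lintegral_add_right _ measurable_const, lintegral_add_left measurable_const,
    lintegral_const_mul _ (by fun_prop), lintegral_logisticRatio] at int
  simp only [lintegral_const, measure_univ, mul_one] at int
  refine ((ENNReal.add_le_add_iff_right ENNReal.ofReal_ne_top).1 int).trans ?_
  exact ENNReal.ofReal_le_ofReal (Real.cosh_le_exp_half_sq _)

/-- One noisy query: changing the query by at most `1` changes the expectation of a function of
the answer by a bounded factor, up to Hölder's inequality. -/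
theorem lintegral_noisy_le {g : ℝ → ENNReal} (hg : Measurable g) {c c' l p q : ℝ} (hl : 0 < l)
    (hc : |c - c'| ≤ 1) (hpq : p.HolderConjugate q) :
    ∫⁻ u, g (c + l * logit u) ≤
      ENNReal.ofReal (Real.exp (q / (2 * l ^ 2))) *
        (∫⁻ u, g (c' + l * logit u) ^ p) ^ (1 / p) := by
  set s := (c' - c) / l with hs
  have hr := measurable_logisticRatio s
  have hlog := measurable_logit
  have hsa : |s| ≤ 1 / l := by
    rw [hs, abs_div, abs_of_pos hl, abs_sub_comm]
    gcongr
  have h1 : ∫⁻ u, g (c + l * logit u) = ∫⁻ u, (fun x => g (c' + l * x)) (logit u - s) := by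
    refine lintegral_congr fun u => ?_
    have : c + l * logit u = c' + l * (logit u - s) := by
      rw [hs]
      field_simp
      ring
    simp only [this]
  rw [h1, lintegral_logit_translate (φ := fun x => g (c' + l * x)) (by fun_prop)]
  refine (ENNReal.lintegral_mul_le_Lp_mul_Lq volume hpq
    (f := fun u => g (c' + l * logit u))
    (g := fun u => ENNReal.ofReal (logisticRatio s (logit u))) (by fun_prop) (by fun_prop)).trans ?_
  rw [mul_comm]
  gcongr
  have hq : 0 < q := hpq.symm.pos
  refine (ENNReal.rpow_le_rpow (lintegral_logisticRatio_rpow_le (by positivity) hsa hq)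
    (by positivity)).trans ?_
  rw [ENNReal.ofReal_rpow_of_pos (Real.exp_pos _), ← Real.exp_mul]
  refine (congrArg (fun t => ENNReal.ofReal (Real.exp t)) ?_).le
  field_simp

theorem lintegral_logit_neg {φ : ℝ → ENNReal} (hφ : Measurable φ) :
    ∫⁻ u, φ (-logit u) = ∫⁻ u, φ (logit u) := by
  have := measurable_logit
  rw [← unitInterval.measurePreserving_symm.lintegral_comp (f := fun u => φ (logit u))
    (by fun_prop)]
  simp only [logit_symm]

theorem lintegral_exp_logit_half_le :
    ∫⁻ u, ENNReal.ofReal (Real.exp (logit u / 2)) ≤ 2 := by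
  have h1 : ∀ u, logit (unitInterval.symm u) ≤ -Real.log u := by
    intro u
    rw [logit_symm, logit]
    rcases eq_or_lt_of_le u.2.2 with h | h
    · simp [h]
    rcases eq_or_lt_of_le u.2.1 with h0 | h0
    · simp [← h0]
    rw [Real.log_div h0.ne' (by linarith)]
    have := Real.log_nonpos (x := 1 - u) (by linarith) (by linarith)
    linarith
  have hm := measurable_logit
  rw [← unitInterval.measurePreserving_symm.lintegral_comp
    (f := fun u => ENNReal.ofReal (Real.exp (logit u / 2))) (by fun_prop)]
  calc ∫⁻ u, ENNReal.ofReal (Real.exp (logit (unitInterval.symm u) / 2))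
      ≤ ∫⁻ u : unitInterval, ENNReal.ofReal (Real.exp (-Real.log u / 2)) := by
        refine lintegral_mono fun u => ENNReal.ofReal_le_ofReal (Real.exp_le_exp.2 ?_)
        linarith [h1 u]
    _ = ∫⁻ x in Set.Ioo (0 : ℝ) 1, ENNReal.ofReal (Real.exp (-Real.log x / 2)) :=
        lintegral_unitInterval (fun x => ENNReal.ofReal (Real.exp (-Real.log x / 2))) (by fun_prop)
    _ = ∫⁻ x in Set.Ioo (0 : ℝ) 1, ENNReal.ofReal (x ^ (-(1 / 2) : ℝ)) := by
        refine setLIntegral_congr_fun measurableSet_Ioo fun x hx => ?_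
        rw [Real.rpow_def_of_pos hx.1]
        congr 2
        ring
    _ = ∫⁻ x in Set.Ioc (0 : ℝ) 1, ENNReal.ofReal (x ^ (-(1 / 2) : ℝ)) :=
        setLIntegral_congr Ioo_ae_eq_Ioc
    _ = ENNReal.ofReal (∫ x in Set.Ioc (0 : ℝ) 1, x ^ (-(1 / 2) : ℝ)) := by
        rw [ofReal_integral_eq_lintegral_ofReal]
        · exact (intervalIntegrable_iff_integrableOn_Ioc_of_le zero_le_one).1
            (intervalIntegral.intervalIntegrable_rpow' (by norm_num))
        · exact (ae_restrict_iff' measurableSet_Ioc).2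
            (Filter.Eventually.of_forall fun x hx => Real.rpow_nonneg hx.1.le _)
    _ ≤ 2 := by
        rw [← intervalIntegral.integral_of_le zero_le_one, integral_rpow (by norm_num)]
        norm_num

theorem cosh_mul_le {t : ℝ} (ht : |t| ≤ 1) (x : ℝ) :
    Real.cosh (t * x) ≤ 1 + t ^ 2 * Real.cosh x := by
  have h1 := Real.hasSum_cosh (t * x)
  have h2 := (hasSum_ite_eq (0 : ℕ) (1 : ℝ)).add ((Real.hasSum_cosh x).mul_left (t ^ 2))
  refine hasSum_le (fun k => ?_) h1 h2
  rcases Nat.eq_zero_or_pos k with rfl | hk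
  · simp
    positivity
  · have hk' : k ≠ 0 := hk.ne'
    simp only [hk', if_false, zero_add]
    rw [mul_pow, ← mul_div_assoc]
    have hx : 0 ≤ x ^ (2 * k) := (even_two_mul k).pow_nonneg x
    have : t ^ (2 * k) ≤ t ^ 2 := by
      rw [← (even_two_mul k).pow_abs, ← sq_abs]
      exact pow_le_pow_of_le_one (abs_nonneg t) ht (by omega)
    gcongr

/-- The logistic law is subexponential. -/
theorem lintegral_exp_logit_le {θ : ℝ} (hθ : |θ| ≤ 1 / 2) :
    ∫⁻ u, ENNReal.ofReal (Real.exp (θ * logit u)) ≤ ENNReal.ofReal (Real.exp (8 * θ ^ 2)) := by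
  have hm := measurable_logit
  have sym : ∀ t : ℝ, ∫⁻ u, ENNReal.ofReal (Real.cosh (t * logit u)) =
      ∫⁻ u, ENNReal.ofReal (Real.exp (t * logit u)) := by
    intro t
    have h := lintegral_logit_neg (φ := fun x => ENNReal.ofReal (Real.exp (t * x))) (by fun_prop)
    have h2 : ∀ u, ENNReal.ofReal (Real.cosh (t * logit u)) =
        ENNReal.ofReal (1 / 2) * (ENNReal.ofReal (Real.exp (t * logit u)) +
          ENNReal.ofReal (Real.exp (t * -logit u))) := by
      intro u
      rw [← ENNReal.ofReal_add (by positivity) (by positivity), ← ENNReal.ofReal_mul (by norm_num),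
        Real.cosh_eq, mul_neg]
      congr 1
      ring
    simp_rw [h2]
    rw [lintegral_const_mul _ (by fun_prop), lintegral_add_left (by fun_prop), h, ← two_mul,
      ← mul_assoc, show (2 : ENNReal) = ENNReal.ofReal 2 by simp,
      ← ENNReal.ofReal_mul (by norm_num)]
    norm_num
  rw [← sym]
  calc ∫⁻ u, ENNReal.ofReal (Real.cosh (θ * logit u))
      ≤ ∫⁻ u, (1 + ENNReal.ofReal ((2 * θ) ^ 2) *
          ENNReal.ofReal (Real.cosh (1 / 2 * logit u))) := by
        refine lintegral_mono fun u => ?_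
        dsimp only
        rw [← ENNReal.ofReal_one, ← ENNReal.ofReal_mul (by positivity),
          ← ENNReal.ofReal_add (by norm_num) (by have := Real.cosh_pos (1 / 2 * logit u); positivity)]
        refine ENNReal.ofReal_le_ofReal ?_
        have := cosh_mul_le (t := 2 * θ) (by rw [abs_mul, abs_two]; linarith) (1 / 2 * logit u)
        rwa [show 2 * θ * (1 / 2 * logit u) = θ * logit u by ring] at this
    _ = 1 + ENNReal.ofReal ((2 * θ) ^ 2) * ∫⁻ u, ENNReal.ofReal (Real.exp (1 / 2 * logit u)) := by
        rw [lintegral_add_left measurable_const, lintegral_const_mul _ (by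
          simp only [Real.cosh_eq]; fun_prop), sym]
        simp
    _ ≤ 1 + ENNReal.ofReal ((2 * θ) ^ 2) * 2 := by
        gcongr
        refine le_trans (le_of_eq ?_) lintegral_exp_logit_half_le
        refine lintegral_congr fun u => ?_
        rw [show 1 / 2 * logit u = logit u / 2 by ring]
    _ = ENNReal.ofReal (1 + 8 * θ ^ 2) := by
        rw [show (2 : ENNReal) = ENNReal.ofReal 2 by simp, ← ENNReal.ofReal_mul (by positivity),
          ← ENNReal.ofReal_one, ← ENNReal.ofReal_add (by norm_num) (by positivity)]
        congr 1
        ring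
    _ ≤ _ := by
        refine ENNReal.ofReal_le_ofReal ?_
        linarith [Real.add_one_le_exp (8 * θ ^ 2)]

end PrivatePacking

/-! ### Adaptive composition -/

namespace PrivatePacking

open RealRAM

/-- The answers to the first `k` of a sequence of adaptively chosen queries. Query `i` is a
function `Q i` of the earlier answers, and is answered with logistic noise of scale `l`. -/
noncomputable def transcript (Q : ℕ → (ℕ → ℝ) → ℝ) (l : ℝ) (ω : ℕ → unitInterval) : ℕ → ℕ → ℝ
  | 0 => 0
  | k + 1 => Function.update (transcript Q l ω k) k (Q k (transcript Q l ω k) + l * logit (ω k))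

section Transcript

variable {Q Q' : ℕ → (ℕ → ℝ) → ℝ} {l : ℝ}

theorem transcript_update (ω : ℕ → unitInterval) (u : unitInterval) {i k : ℕ} (h : k ≤ i) :
    transcript Q l (Function.update ω i u) k = transcript Q l ω k := by
  induction k with
  | zero => rfl
  | succ k ih =>
    have : k ≠ i := by omega
    simp [transcript, ih (by omega), Function.update_of_ne this]

theorem transcript_apply (ω : ℕ → unitInterval) {i k : ℕ} (h : i < k) :
    transcript Q l ω k i = Q i (transcript Q l ω i) + l * logit (ω i) := by
  induction k with
  | zero => omega
  | succ k ih =>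
    rcases Nat.lt_succ_iff_lt_or_eq.1 h with h | rfl
    · rw [transcript, Function.update_of_ne h.ne, ih h]
    · simp [transcript]

theorem measurable_update_real (k : ℕ) :
    Measurable (fun x : (ℕ → ℝ) × ℝ => Function.update x.1 k x.2) := by
  refine measurable_pi_lambda _ fun i => ?_
  by_cases h : i = k
  · subst h
    simpa using measurable_snd
  · simp only [Function.update_of_ne h]
    fun_prop

theorem measurable_transcript (hQ : ∀ k, Measurable (Q k)) (k : ℕ) :
    Measurable (fun ω => transcript Q l ω k) := by
  induction k with
  | zero => exact measurable_const
  | succ k ih =>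
    have hm := measurable_logit
    have hk := hQ k
    exact (measurable_update_real k).comp (ih.prodMk (by fun_prop :
      Measurable fun ω : ℕ → unitInterval => Q k (transcript Q l ω k) + l * logit (ω k)))

/-- Adaptive composition: the bound for one noisy query multiplies up. The induction peels off the
last query; the Hölder form of the bound is what makes it go through. -/
theorem lintegral_transcript_le (hQ : ∀ k, Measurable (Q k)) (hQ' : ∀ k, Measurable (Q' k))
    (hl : 0 < l) (hd : ∀ k h, |Q k h - Q' k h| ≤ 1) {p q : ℝ} (hpq : p.HolderConjugate q) (K : ℕ) :
    ∀ G : (ℕ → ℝ) → ENNReal, Measurable G →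
      ∫⁻ ω, G (transcript Q l ω K) ∂coins ≤
        ENNReal.ofReal (Real.exp (q / (2 * l ^ 2))) ^ K *
          (∫⁻ ω, G (transcript Q' l ω K) ^ p ∂coins) ^ (1 / p) := by
  have hm := measurable_logit
  have hp : p ≠ 0 := hpq.ne_zero
  have step : ∀ {R : ℕ → (ℕ → ℝ) → ℝ} (K : ℕ) (_ : ∀ k, Measurable (R k))
      (G : (ℕ → ℝ) → ENNReal) (_ : Measurable G),
      ∫⁻ ω, G (transcript R l ω (K + 1)) ∂coins =
        ∫⁻ ω, (∫⁻ u, G (Function.update (transcript R l ω K) K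
          (R K (transcript R l ω K) + l * logit u))) ∂coins := by
    intro R K hR G hG
    have h1 := measurable_transcript (l := l) hR (K + 1)
    rw [lintegral_coins_update K (by fun_prop)]
    refine lintegral_congr fun ω => lintegral_congr fun u => ?_
    simp only [transcript, transcript_update ω u le_rfl, Function.update_self]
  induction K with
  | zero =>
    intro G hG
    simp only [transcript, lintegral_const, measure_univ, mul_one, pow_zero, one_mul]
    rw [← ENNReal.rpow_mul, mul_one_div_cancel hp, ENNReal.rpow_one]
  | succ K ih =>
    intro G hG
    have hup := measurable_update_real K
    have hQK := hQ' K
    set H : (ℕ → ℝ) → ENNReal := fun h =>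
      (∫⁻ u, G (Function.update h K (Q' K h + l * logit u)) ^ p) ^ (1 / p) with hH
    have hjoint : Measurable (fun x : (ℕ → ℝ) × unitInterval =>
        G (Function.update x.1 K (Q' K x.1 + l * logit x.2))) :=
      hG.comp (hup.comp (measurable_fst.prodMk (by fun_prop)))
    have hHm : Measurable H :=
      (Measurable.lintegral_prod_right' (hjoint.pow_const p)).pow_const (1 / p)
    calc ∫⁻ ω, G (transcript Q l ω (K + 1)) ∂coins
        = ∫⁻ ω, (∫⁻ u, G (Function.update (transcript Q l ω K) K
          (Q K (transcript Q l ω K) + l * logit u))) ∂coins := step K hQ G hG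
      _ ≤ ∫⁻ ω, ENNReal.ofReal (Real.exp (q / (2 * l ^ 2))) * H (transcript Q l ω K) ∂coins := by
          refine lintegral_mono fun ω => ?_
          exact lintegral_noisy_le (g := fun y => G (Function.update (transcript Q l ω K) K y))
            (hG.comp (hup.comp (measurable_const.prodMk measurable_id))) hl (hd K _) hpq
      _ = ENNReal.ofReal (Real.exp (q / (2 * l ^ 2))) * ∫⁻ ω, H (transcript Q l ω K) ∂coins :=
          lintegral_const_mul _ (hHm.comp (measurable_transcript hQ K))
      _ ≤ ENNReal.ofReal (Real.exp (q / (2 * l ^ 2))) *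
            (ENNReal.ofReal (Real.exp (q / (2 * l ^ 2))) ^ K *
              (∫⁻ ω, H (transcript Q' l ω K) ^ p ∂coins) ^ (1 / p)) := by
          gcongr
          exact ih H hHm
      _ = _ := by
          rw [← mul_assoc, ← pow_succ', step K hQ' (fun h => G h ^ p) (hG.pow_const p)]
          congr 2
          refine lintegral_congr fun ω => ?_
          rw [hH]
          dsimp only
          rw [← ENNReal.rpow_mul, one_div_mul_cancel hp, ENNReal.rpow_one]

/-- Approximate differential privacy of the transcript: Young's inequality turns the Hölder bound
for the indicator function of an event into an additive one. -/
theorem coins_transcript_le (hQ : ∀ k, Measurable (Q k)) (hQ' : ∀ k, Measurable (Q' k))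
    (hl : 0 < l) (hd : ∀ k h, |Q k h - Q' k h| ≤ 1) {q ε δ : ℝ} (hq : 1 < q) (hδ : 0 < δ) (K : ℕ)
    (hK : q * (K * (q / (2 * l ^ 2))) - ε * (q - 1) ≤ Real.log δ)
    {A : Set (ℕ → ℝ)} (hA : MeasurableSet A) :
    coins {ω | transcript Q l ω K ∈ A} ≤
      ENNReal.ofReal (Real.exp ε) * coins {ω | transcript Q' l ω K ∈ A} + ENNReal.ofReal δ := by
  obtain ⟨p, hpq⟩ : ∃ p, Real.HolderConjugate p q :=
    ⟨_, (Real.HolderConjugate.conjExponent hq).symm⟩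
  have hp0 := hpq.pos
  have hq0 : 0 < q := by linarith
  have h := lintegral_transcript_le hQ hQ' hl hd hpq K (A.indicator 1)
    (measurable_one.indicator hA)
  have e1 : ∫⁻ ω, A.indicator 1 (transcript Q l ω K) ∂coins =
      coins {ω | transcript Q l ω K ∈ A} := by
    rw [← lintegral_indicator_one (show MeasurableSet {ω | transcript Q l ω K ∈ A} from
      measurable_transcript hQ K hA)]
    rfl
  have e2 : ∫⁻ ω, (A.indicator 1 (transcript Q' l ω K) : ENNReal) ^ p ∂coins =
      coins {ω | transcript Q' l ω K ∈ A} := by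
    rw [← lintegral_indicator_one (show MeasurableSet {ω | transcript Q' l ω K ∈ A} from
      measurable_transcript hQ' K hA)]
    refine lintegral_congr fun ω => ?_
    by_cases hω : transcript Q' l ω K ∈ A
    · simp [Set.indicator, hω]
    · simp [Set.indicator, hω, hp0]
  rw [e1, e2] at h
  refine h.trans ?_
  set x := coins {ω | transcript Q' l ω K ∈ A}
  set c := K * (q / (2 * l ^ 2)) with hc
  have young := ENNReal.young_inequality
    ((ENNReal.ofReal (Real.exp ε) * x) ^ (1 / p)) (ENNReal.ofReal (Real.exp (c - ε / p))) hpq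
  have l1 : (ENNReal.ofReal (Real.exp ε) * x) ^ (1 / p) * ENNReal.ofReal (Real.exp (c - ε / p)) =
      ENNReal.ofReal (Real.exp (q / (2 * l ^ 2))) ^ K * x ^ (1 / p) := by
    rw [ENNReal.mul_rpow_of_nonneg _ _ (by positivity), ENNReal.ofReal_rpow_of_pos (Real.exp_pos _),
      ← Real.exp_mul, mul_right_comm, ← ENNReal.ofReal_mul (Real.exp_pos _).le, ← Real.exp_add,
      ← ENNReal.ofReal_pow (Real.exp_pos _).le, ← Real.exp_nat_mul]
    congr 3
    rw [hc]
    ring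
  have l2 : ((ENNReal.ofReal (Real.exp ε) * x) ^ (1 / p)) ^ p / ENNReal.ofReal p ≤
      ENNReal.ofReal (Real.exp ε) * x := by
    rw [← ENNReal.rpow_mul, one_div_mul_cancel hp0.ne', ENNReal.rpow_one]
    exact ENNReal.div_le_of_le_mul (le_mul_of_one_le_right zero_le
      (ENNReal.one_le_ofReal.2 hpq.lt.le))
  have l3 : ENNReal.ofReal (Real.exp (c - ε / p)) ^ q / ENNReal.ofReal q ≤ ENNReal.ofReal δ := by
    refine (ENNReal.div_le_of_le_mul (le_mul_of_one_le_right zero_le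
      (ENNReal.one_le_ofReal.2 hq.le))).trans ?_
    rw [ENNReal.ofReal_rpow_of_pos (Real.exp_pos _), ← Real.exp_mul]
    refine ENNReal.ofReal_le_ofReal ?_
    rw [← Real.exp_log hδ, Real.exp_le_exp]
    refine le_trans (le_of_eq ?_) hK
    have : q / p = q - 1 := hpq.symm.div_conj_eq_sub_one
    rw [sub_mul, div_mul_eq_mul_div, mul_div_assoc, this]
    ring
  rw [l1] at young
  exact young.trans (add_le_add l2 l3)

end Transcript

/-! ### Joint privacy of the mechanism -/

namespace Params

variable {n m : ℕ} {p : Params n m}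

theorem Valid.m_pos' (hp : p.Valid) : (0 : ℝ) < m := by exact_mod_cast hp.m_pos

theorem Valid.n_pos' (hp : p.Valid) : (0 : ℝ) < n := by exact_mod_cast hp.n_pos

theorem Valid.logFactor_eq (hp : p.Valid) :
    p.logFactor = 1 + Real.log (m + 1) + Real.log (1 / p.δ) := by
  have := hp.m_pos'
  rw [logFactor, Real.log_div (by positivity) hp.δ_pos.ne', one_div, Real.log_inv]
  ring

theorem Valid.log_inv_δ_nonneg (hp : p.Valid) : 0 ≤ Real.log (1 / p.δ) := by
  refine Real.log_nonneg ?_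
  rw [le_div_iff₀ hp.δ_pos, one_mul]
  exact hp.δ_lt.le

theorem log_natCast_add_one_nonneg (m : ℕ) : 0 ≤ Real.log (m + 1) :=
  Real.log_nonneg (by simp)

theorem Valid.one_le_logFactor (hp : p.Valid) : 1 ≤ p.logFactor := by
  rw [hp.logFactor_eq]
  linarith [hp.log_inv_δ_nonneg, log_natCast_add_one_nonneg m]

theorem Valid.logFactor_pos (hp : p.Valid) : 0 < p.logFactor :=
  zero_lt_one.trans_le hp.one_le_logFactor

theorem le_side (p : Params n m) : 256 * p.logFactor * m / (p.α * p.α) ≤ p.side :=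
  Nat.le_ceil _

theorem Valid.side_pos (hp : p.Valid) : (0 : ℝ) < p.side := by
  have := hp.m_pos'
  have := hp.logFactor_pos
  have := hp.α_pos
  exact lt_of_lt_of_le (by positivity) p.le_side

theorem Valid.noiseScale_pos (hp : p.Valid) : 0 < p.noiseScale := by
  have := hp.m_pos'
  have := hp.logFactor_pos
  have := hp.side_pos
  have := hp.ε_pos
  unfold noiseScale
  positivity

theorem buys_nonneg (S : Fin m → ℝ) (A : Agent m) : 0 ≤ p.buys S A := by
  unfold buys
  split_ifs <;> simp

theorem buys_le_one (S : Fin m → ℝ) (A : Agent m) : p.buys S A ≤ 1 := by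
  unfold buys
  split_ifs <;> simp

theorem measurable_price (j : Fin m) : Measurable (fun S => p.price S j) := by
  unfold price weight normalizer
  fun_prop

theorem measurable_buys (A : Agent m) : Measurable (fun S => p.buys S A) := by
  have := p.measurable_price
  unfold buys
  refine Measurable.ite (measurableSet_lt (by fun_prop) measurable_const) measurable_const
    measurable_const

theorem measurable_load (D : Dataset n m) (j : Fin m) : Measurable (fun S => p.load D S j) := by
  have := fun A => p.measurable_buys A
  unfold load
  fun_prop

theorem abs_load_sub_le {i : Fin n} {D D' : Dataset n m} (h : Neighbors i D D') (S : Fin m → ℝ)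
    (j : Fin m) : |p.load D S j - p.load D' S j| ≤ 1 := by
  have mem : ∀ A : Agent m, 0 ≤ (A.demand j : ℝ) * p.buys S A ∧
      (A.demand j : ℝ) * p.buys S A ≤ 1 := fun A =>
    ⟨mul_nonneg (A.demand j).2.1 (buys_nonneg S A),
      mul_le_one₀ (A.demand j).2.2 (buys_nonneg S A) (buys_le_one S A)⟩
  have : p.load D S j - p.load D' S j =
      ((D i).demand j : ℝ) * p.buys S (D i) - ((D' i).demand j : ℝ) * p.buys S (D' i) := by
    unfold load
    rw [← Finset.sum_sub_distrib]
    refine Finset.sum_eq_single i (fun l _ hl => ?_) (by simp)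
    rw [h l hl, sub_self]
  rw [this, abs_le]
  constructor <;> linarith [(mem (D i)).1, (mem (D i)).2, (mem (D' i)).1, (mem (D' i)).2]

/-- The cumulative noisy excess load after `t` rounds, as a function of the noisy loads. -/
noncomputable def stateOf (p : Params n m) (h : ℕ → ℝ) (t : ℕ) (j : Fin m) : ℝ :=
  ∑ r ∈ Finset.range t, (h (r * m + j) - p.target)

/-- The queries of the mechanism, as functions of the earlier answers: query `t * m + j` asks for
the load of resource `j` in round `t`. -/
noncomputable def query (p : Params n m) (hm : 0 < m) (D : Dataset n m) (k : ℕ) (h : ℕ → ℝ) : ℝ :=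
  p.load D (p.stateOf h (k / m)) ⟨k % m, Nat.mod_lt k hm⟩

theorem measurable_stateOf (t : ℕ) : Measurable (fun h => p.stateOf h t) := by
  unfold stateOf
  fun_prop

theorem measurable_query (hm : 0 < m) (D : Dataset n m) (k : ℕ) : Measurable (p.query hm D k) :=
  (p.measurable_load D _).comp (p.measurable_stateOf _)

theorem dualState_eq_stateOf (hm : 0 < m) (D : Dataset n m) (ω : ℕ → unitInterval) (t : ℕ) :
    ∀ k, t * m ≤ k →
      dualState p D ω t = p.stateOf (transcript (p.query hm D) p.noiseScale ω k) t := by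
  induction t with
  | zero =>
    intro k _
    ext j
    simp [dualState, stateOf]
  | succ t ih =>
    intro k hk
    ext j
    have hlt : t * m + j < k := by
      have : (t + 1) * m = t * m + m := by ring
      omega
    have hdiv : (t * m + j) / m = t := by
      rw [mul_comm, Nat.mul_add_div hm, Nat.div_eq_of_lt j.2, add_zero]
    have hmod : (t * m + j) % m = j := by
      rw [mul_comm, Nat.mul_add_mod, Nat.mod_eq_of_lt j.2]
    rw [stateOf, Finset.sum_range_succ, transcript_apply ω hlt, dualState]
    change _ = p.stateOf _ t j + _
    rw [← ih k (by omega), query]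
    simp only [hdiv, hmod]
    rw [← ih (t * m + j) (by omega)]
    ring

/-- The allocation of an agent is a function of her own data and of the noisy loads. -/
noncomputable def outputOf (p : Params n m) (h : ℕ → ℝ) (A : Agent m) : ℝ :=
  ∑ t ∈ Finset.range (p.side * p.side), p.buys (p.stateOf h t) A / p.rounds

theorem measurable_outputOf (A : Agent m) : Measurable (fun h => p.outputOf h A) := by
  have h1 := fun t => (p.measurable_buys A).comp (p.measurable_stateOf t)
  unfold outputOf
  exact Finset.measurable_sum _ fun t _ => (h1 t).div_const _

theorem output_eq_outputOf (hm : 0 < m) (D : Dataset n m) (ω : ℕ → unitInterval) (i : Fin n) :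
    output p D ω i =
      p.outputOf (transcript (p.query hm D) p.noiseScale ω (p.side * p.side * m)) (D i) := by
  refine Finset.sum_congr rfl fun t ht => ?_
  rw [← dualState_eq_stateOf hm D ω t _
    (Nat.mul_le_mul_right m (Finset.mem_range.1 ht).le)]

end Params

variable {n m : ℕ} {p : Params n m}

theorem output_jointlyPrivate (hp : p.Valid) :
    JointlyPrivate coins (fun (D : Dataset n m) ω x => output p D ω = x) p.ε p.δ := by
  intro i D D' hD S hS
  have hm : 0 < m := hp.m_pos
  set A : Set (ℕ → ℝ) := {h | (fun j : {j : Fin n // j ≠ i} => p.outputOf h (D j)) ∈ S} with hA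
  have hmeas : Measurable (fun (h : ℕ → ℝ) (j : {j : Fin n // j ≠ i}) => p.outputOf h (D j)) :=
    measurable_pi_lambda _ fun j => p.measurable_outputOf (D j)
  have hAm : MeasurableSet A := hmeas hS
  have e : ∀ E : Dataset n m, (∀ j : {j : Fin n // j ≠ i}, E j = D j) →
      {ω | ∃ x, output p E ω = x ∧ (fun j : {j : Fin n // j ≠ i} => x j) ∈ S} =
        {ω | transcript (p.query hm E) p.noiseScale ω (p.side * p.side * m) ∈ A} := by
    intro E hE
    ext ω
    simp only [Set.mem_ofPred_eq, exists_eq_left', hA]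
    simp only [p.output_eq_outputOf hm, hE]
  rw [e D (fun _ => rfl), e D' (fun j => (hD j j.2).symm)]
  have hG := hp.one_le_logFactor
  have hG0 := hp.logFactor_pos
  have hε := hp.ε_pos
  have hs := hp.side_pos
  have hm' := hp.m_pos'
  -- the order of the moments: it balances the two error terms of the composition bound
  refine coins_transcript_le (q := 1 + 2 * p.logFactor / p.ε) (p.measurable_query hm D)
    (p.measurable_query hm D') hp.noiseScale_pos (fun k h => p.abs_load_sub_le hD _ _)
    (by have : 0 < 2 * p.logFactor / p.ε := by positivity
        linarith) hp.δ_pos _ ?_ hAm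
  have hsq : √(m : ℝ) ^ 2 = m := Real.sq_sqrt hm'.le
  have h1 : (1 + 2 * p.logFactor / p.ε) * (((p.side * p.side * m : ℕ) : ℝ) *
      ((1 + 2 * p.logFactor / p.ε) / (2 * p.noiseScale ^ 2))) =
      (p.ε + 2 * p.logFactor) ^ 2 / (8 * p.logFactor ^ 2) := by
    rw [Params.noiseScale, div_pow, mul_pow, mul_pow, hsq]
    push_cast
    field_simp
    ring
  have h2 : p.ε * (1 + 2 * p.logFactor / p.ε - 1) = 2 * p.logFactor := by
    field_simp
    ring
  have h3 : p.ε ≤ p.logFactor := by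
    rw [hp.logFactor_eq]
    linarith [hp.ε_le, Params.log_natCast_add_one_nonneg m]
  have h4 : (p.ε + 2 * p.logFactor) ^ 2 / (8 * p.logFactor ^ 2) ≤ 9 / 8 := by
    rw [div_le_iff₀ (by positivity)]
    nlinarith
  have h5 : Real.log p.δ = -Real.log (1 / p.δ) := by rw [one_div, Real.log_inv, neg_neg]
  rw [h1, h2, h5]
  have h6 := hp.logFactor_eq
  linarith [hp.log_inv_δ_nonneg, Params.log_natCast_add_one_nonneg m]

end PrivatePacking

/-! ### Multiplicative weights -/

namespace PrivatePacking

open RealRAM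

namespace Params

variable {n m : ℕ} {p : Params n m}

/-- The excess load of a resource under the best responses. -/
noncomputable def excess (p : Params n m) (D : Dataset n m) (S : Fin m → ℝ) (j : Fin m) : ℝ :=
  p.load D S j - p.target

/-- The cumulative excess load after a round whose noise is left out. -/
noncomputable def noiseless (p : Params n m) (D : Dataset n m) (S : Fin m → ℝ) (j : Fin m) : ℝ :=
  S j + p.excess D S j

/-- A bound on the excess load of a resource. -/
noncomputable def width (p : Params n m) : ℝ := 4 * m * p.b / p.α

theorem normalizer_pos (p : Params n m) (S : Fin m → ℝ) : 0 < p.normalizer S := by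
  unfold normalizer
  positivity

theorem one_le_normalizer (p : Params n m) (S : Fin m → ℝ) : 1 ≤ p.normalizer S := by
  unfold normalizer
  have : 0 ≤ ∑ j, Real.exp (p.rate * S j) := by positivity
  linarith

theorem exp_le_normalizer (p : Params n m) (S : Fin m → ℝ) (j : Fin m) :
    Real.exp (p.rate * S j) ≤ p.normalizer S := by
  unfold normalizer
  have := Finset.single_le_sum (f := fun j => Real.exp (p.rate * S j))
    (fun _ _ => (Real.exp_pos _).le) (Finset.mem_univ j)
  linarith

theorem weight_nonneg (p : Params n m) (S : Fin m → ℝ) (j : Fin m) : 0 ≤ p.weight S j :=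
  div_nonneg (Real.exp_pos _).le (p.normalizer_pos S).le

/-- The weights of the resources and of the dummy resource add up to one. -/
theorem inv_normalizer_add_sum_weight (p : Params n m) (S : Fin m → ℝ) :
    (p.normalizer S)⁻¹ + ∑ j, p.weight S j = 1 := by
  unfold weight
  rw [← Finset.sum_div, inv_eq_one_div, ← add_div]
  exact div_self (p.normalizer_pos S).ne'

theorem sum_weight_le_one (p : Params n m) (S : Fin m → ℝ) : ∑ j, p.weight S j ≤ 1 := by
  have h := p.inv_normalizer_add_sum_weight S
  have := inv_pos.2 (p.normalizer_pos S)
  linarith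

theorem normalizer_div (p : Params n m) (S d : Fin m → ℝ) :
    p.normalizer (fun j => S j + d j) / p.normalizer S =
      (p.normalizer S)⁻¹ + ∑ j, p.weight S j * Real.exp (p.rate * d j) := by
  have h := p.normalizer_pos S
  rw [div_eq_iff h.ne', add_mul, inv_mul_cancel₀ h.ne', Finset.sum_mul, normalizer]
  congr 1
  refine Finset.sum_congr rfl fun j _ => ?_
  rw [weight, mul_add, Real.exp_add]
  field_simp

theorem Valid.base_pos (hp : p.Valid) : 0 < p.base := by
  have := hp.m_pos'
  have := hp.n_pos'
  have := hp.α_pos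
  have := hp.b_pos
  unfold base
  positivity

theorem Valid.cap_pos (hp : p.Valid) : 0 < p.cap := by
  have := hp.n_pos'
  have := hp.b_pos
  unfold cap
  positivity

theorem Valid.rounds_pos (hp : p.Valid) : 0 < p.rounds := mul_pos hp.side_pos hp.side_pos

theorem Valid.rate_pos (hp : p.Valid) : 0 < p.rate := by
  have := hp.α_pos
  have := hp.b_pos
  have := hp.rounds_pos
  have := hp.logFactor_pos
  unfold rate
  positivity

theorem Valid.width_pos (hp : p.Valid) : 0 < p.width := by
  have := hp.α_pos
  have := hp.b_pos
  have := hp.m_pos'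
  unfold width
  positivity

theorem Valid.target_pos (hp : p.Valid) : 0 < p.target := by
  have := hp.α_lt
  have := hp.b_pos
  unfold target
  nlinarith

theorem Valid.target_le (hp : p.Valid) : p.target ≤ p.b := by
  have := mul_pos hp.α_pos hp.b_pos
  unfold target
  linarith

theorem Valid.base_le_price (hp : p.Valid) (S : Fin m → ℝ) (j : Fin m) : p.base ≤ p.price S j := by
  have := mul_nonneg hp.cap_pos.le (p.weight_nonneg S j)
  unfold price
  linarith

/-- The base price keeps the demand of each buying agent below `1 / base`. -/
theorem Valid.load_le_width (hp : p.Valid) (D : Dataset n m) (S : Fin m → ℝ) (j : Fin m) :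
    p.load D S j ≤ p.width := by
  have hb := hp.base_pos
  have key : ∀ i, ((D i).demand j : ℝ) * p.buys S (D i) ≤ 1 / p.base := by
    intro i
    unfold buys
    split_ifs with h
    · rw [mul_one, le_div_iff₀ hb]
      have hterm : ∀ k, 0 ≤ ((D i).demand k : ℝ) * p.price S k := fun k =>
        mul_nonneg ((D i).demand k).2.1 (hb.le.trans (hp.base_le_price S k))
      calc ((D i).demand j : ℝ) * p.base ≤ (D i).demand j * p.price S j :=
            mul_le_mul_of_nonneg_left (hp.base_le_price S j) ((D i).demand j).2.1
        _ ≤ ∑ k, ((D i).demand k : ℝ) * p.price S k :=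
            Finset.single_le_sum (f := fun k => ((D i).demand k : ℝ) * p.price S k)
              (fun k _ => hterm k) (Finset.mem_univ j)
        _ ≤ 1 := h.le.trans (D i).value.2.2
    · rw [mul_zero]
      positivity
  calc p.load D S j ≤ ∑ _i : Fin n, 1 / p.base := Finset.sum_le_sum fun i _ => key i
    _ = p.width := by
      have := hp.m_pos'
      have := hp.n_pos'
      have := hp.α_pos
      have := hp.b_pos
      rw [Finset.sum_const, Finset.card_univ, Fintype.card_fin, nsmul_eq_mul, base, width]
      field_simp

theorem load_nonneg (p : Params n m) (D : Dataset n m) (S : Fin m → ℝ) (j : Fin m) :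
    0 ≤ p.load D S j :=
  Finset.sum_nonneg fun i _ => mul_nonneg ((D i).demand j).2.1 (buys_nonneg S (D i))

theorem Valid.abs_excess_le (hp : p.Valid) (D : Dataset n m) (S : Fin m → ℝ) (j : Fin m) :
    |p.excess D S j| ≤ p.width := by
  have h1 := hp.load_le_width D S j
  have h2 := p.load_nonneg D S j
  have h3 := hp.target_pos
  have h4 := hp.target_le
  have h5 : p.b ≤ p.width := by
    have := hp.b_pos
    have hm : (1 : ℝ) ≤ m := by exact_mod_cast hp.m_pos
    rw [width, le_div_iff₀ hp.α_pos]
    have := hp.α_lt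
    nlinarith
  unfold excess
  rw [abs_le]
  constructor <;> linarith

theorem exp_le_one_add_add_sq {y : ℝ} (hy : |y| ≤ 1) : Real.exp y ≤ 1 + y + y ^ 2 := by
  have := Real.abs_exp_sub_one_sub_id_le hy
  have := (abs_le.1 this).2
  linarith

/-- The effect of the (noiseless) excess load of one round on the potential. -/
theorem Valid.log_normalizer_noiseless_le (hp : p.Valid) (D : Dataset n m) (S : Fin m → ℝ)
    (hw : p.rate * p.width ≤ 1) :
    Real.log (p.normalizer (p.noiseless D S)) ≤ Real.log (p.normalizer S) +
      p.rate * ∑ j, p.weight S j * p.excess D S j + (p.rate * p.width) ^ 2 := by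
  have h0 := p.normalizer_pos S
  have h1 := p.normalizer_div S (p.excess D S)
  have h2 : ∀ j, p.weight S j * Real.exp (p.rate * p.excess D S j) ≤
      p.weight S j + p.rate * (p.weight S j * p.excess D S j) +
        p.weight S j * (p.rate * p.width) ^ 2 := by
    intro j
    have hW := hp.abs_excess_le D S j
    have hr := hp.rate_pos
    have h3 : |p.rate * p.excess D S j| ≤ p.rate * p.width := by
      rw [abs_mul, abs_of_pos hr]
      gcongr
    have h4 := exp_le_one_add_add_sq (h3.trans hw)
    have h5 : (p.rate * p.excess D S j) ^ 2 ≤ (p.rate * p.width) ^ 2 :=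
      sq_le_sq' (abs_le.1 h3).1 (abs_le.1 h3).2
    have h6 := mul_le_mul_of_nonneg_left (h4.trans (add_le_add_right h5 _)) (p.weight_nonneg S j)
    linarith
  have h3 := Finset.sum_le_sum fun j (_ : j ∈ Finset.univ) => h2 j
  rw [Finset.sum_add_distrib, Finset.sum_add_distrib, ← Finset.mul_sum, ← Finset.sum_mul] at h3
  have h4 := mul_le_mul_of_nonneg_right (p.sum_weight_le_one S) (sq_nonneg (p.rate * p.width))
  have h5 := p.inv_normalizer_add_sum_weight S
  have h6 := Real.log_le_sub_one_of_pos (div_pos (p.normalizer_pos (p.noiseless D S)) h0)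
  rw [Real.log_div (p.normalizer_pos _).ne' h0.ne'] at h6
  change p.normalizer (p.noiseless D S) / _ = _ at h1
  linarith

/-- The effect of the noise of one round on the potential, by Jensen's inequality. -/
theorem normalizer_div_rpow_le (p : Params n m) (S d : Fin m → ℝ) {κ : ℝ} (hκ : 1 ≤ κ) :
    (p.normalizer (fun j => S j + d j) / p.normalizer S) ^ κ ≤
      (p.normalizer S)⁻¹ + ∑ j, p.weight S j * Real.exp (κ * p.rate * d j) := by
  have h := Real.rpow_arith_mean_le_arith_mean_rpow (Finset.univ : Finset (Option (Fin m)))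
    (fun o => o.elim (p.normalizer S)⁻¹ (p.weight S))
    (fun o => o.elim 1 (fun j => Real.exp (p.rate * d j)))
    (by
      rintro (_ | j) -
      · exact (inv_pos.2 (p.normalizer_pos S)).le
      · exact p.weight_nonneg S j)
    (by simpa using p.inv_normalizer_add_sum_weight S)
    (by
      rintro (_ | j) -
      · exact zero_le_one
      · exact (Real.exp_pos _).le) hκ
  simp only [Fintype.sum_option, Option.elim_none, Option.elim_some, mul_one, Real.one_rpow,
    ← Real.exp_mul] at h
  rw [p.normalizer_div]
  refine h.trans (le_of_eq ?_)
  congr 1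
  refine Finset.sum_congr rfl fun j _ => ?_
  congr 2
  ring

end Params

/-! ### Concentration of the noise -/

section Noise

variable {n m : ℕ} {p : Params n m}

theorem dualState_update (D : Dataset n m) (ω : ℕ → unitInterval) (u : unitInterval) {i t : ℕ}
    (h : t * m ≤ i) : dualState p D (Function.update ω i u) t = dualState p D ω t := by
  induction t with
  | zero => rfl
  | succ t ih =>
    have e : (t + 1) * m = t * m + m := by ring
    ext j
    have : t * m + j ≠ i := by omega
    simp only [dualState, ih (by omega), Function.update_of_ne this]

theorem measurable_dualState (D : Dataset n m) (t : ℕ) :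
    Measurable (fun ω => dualState p D ω t) := by
  induction t with
  | zero => exact measurable_const
  | succ t ih =>
    refine measurable_pi_lambda _ fun j => ?_
    have h1 : Measurable fun ω => p.load D (dualState p D ω t) j := (p.measurable_load D j).comp ih
    have h2 : Measurable fun ω => dualState p D ω t j := (measurable_pi_apply j).comp ih
    have h3 := measurable_logit
    simp only [dualState]
    fun_prop

theorem lintegral_mul_fresh {F : (ℕ → unitInterval) → ENNReal} (hF : Measurable F) {i : ℕ}
    (h : ∀ ω u, F (Function.update ω i u) = F ω) {φ : unitInterval → ENNReal} (hφ : Measurable φ) :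
    ∫⁻ ω, F ω * φ (ω i) ∂coins = (∫⁻ ω, F ω ∂coins) * ∫⁻ u, φ u := by
  rw [lintegral_coins_update i (by fun_prop), ← lintegral_mul_const _ hF]
  refine lintegral_congr fun ω => ?_
  simp only [h, Function.update_self]
  exact lintegral_const_mul _ hφ

/-- The factor by which the noise of round `t` changes the normaliser. -/
noncomputable def noiseGrowth (p : Params n m) (D : Dataset n m) (ω : ℕ → unitInterval) (t : ℕ) :
    ℝ :=
  p.normalizer (dualState p D ω (t + 1)) / p.normalizer (p.noiseless D (dualState p D ω t))

theorem noiseGrowth_pos (D : Dataset n m) (ω : ℕ → unitInterval) (t : ℕ) :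
    0 < noiseGrowth p D ω t :=
  div_pos (p.normalizer_pos _) (p.normalizer_pos _)

theorem measurable_normalizer : Measurable p.normalizer := by
  unfold Params.normalizer
  fun_prop

theorem measurable_weight (j : Fin m) : Measurable fun S => p.weight S j := by
  unfold Params.weight Params.normalizer
  fun_prop

theorem measurable_noiseless (D : Dataset n m) : Measurable (p.noiseless D) := by
  refine measurable_pi_lambda _ fun j => ?_
  have := p.measurable_load D j
  unfold Params.noiseless Params.excess
  fun_prop

theorem measurable_noiseGrowth (D : Dataset n m) (t : ℕ) :
    Measurable fun ω => noiseGrowth p D ω t := by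
  have h := measurable_normalizer (p := p)
  exact (h.comp (measurable_dualState D (t + 1))).div
    (h.comp ((measurable_noiseless D).comp (measurable_dualState D t)))

/-- The exponential supermartingale that controls the effect of the noise on the potential. -/
theorem lintegral_prod_noiseGrowth_le (D : Dataset n m) {κ : ℝ} (hκ : 1 ≤ κ)
    (hθ : |κ * p.rate * p.noiseScale| ≤ 1 / 2) (T : ℕ) :
    ∫⁻ ω, ∏ t ∈ Finset.range T, ENNReal.ofReal (noiseGrowth p D ω t ^ κ) ∂coins ≤
      ENNReal.ofReal (Real.exp (8 * (κ * p.rate * p.noiseScale) ^ 2)) ^ T := by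
  set θ := κ * p.rate * p.noiseScale with hθdef
  set E := ENNReal.ofReal (Real.exp (8 * θ ^ 2)) with hE
  have hE1 : 1 ≤ E := ENNReal.one_le_ofReal.2 (Real.one_le_exp (by positivity))
  induction T with
  | zero => simp
  | succ T ih =>
    set A : (ℕ → unitInterval) → ENNReal := fun ω =>
      ∏ t ∈ Finset.range T, ENNReal.ofReal (noiseGrowth p D ω t ^ κ) with hA
    have hAm : Measurable A := Finset.measurable_prod _ fun t _ =>
      ((measurable_noiseGrowth D t).pow_const κ).ennreal_ofReal
    set B : (ℕ → unitInterval) → Fin m → ℝ := fun ω => p.noiseless D (dualState p D ω T) with hB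
    have hBm : Measurable B := (measurable_noiseless D).comp (measurable_dualState D T)
    have hAu : ∀ (j : Fin m) ω u, A (Function.update ω (T * m + j) u) = A ω := by
      intro j ω u
      refine Finset.prod_congr rfl fun t ht => ?_
      have h1 : (t + 1) * m ≤ T * m := Nat.mul_le_mul_right m (Finset.mem_range.1 ht)
      have h2 : t * m ≤ T * m := Nat.mul_le_mul_right m (Finset.mem_range.1 ht).le
      rw [noiseGrowth, dualState_update D ω u (by omega), dualState_update D ω u (by omega),
        noiseGrowth]
    have hBu : ∀ (j : Fin m) ω u, B (Function.update ω (T * m + j) u) = B ω := by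
      intro j ω u
      rw [hB]
      dsimp only
      rw [dualState_update D ω u (by omega)]
    have hl := measurable_logit
    have hwm : ∀ j, Measurable fun ω => ENNReal.ofReal (p.weight (B ω) j) := fun j =>
      ((measurable_weight j).comp hBm).ennreal_ofReal
    have hnm : Measurable fun ω => ENNReal.ofReal (p.normalizer (B ω))⁻¹ :=
      (measurable_normalizer.comp hBm).inv.ennreal_ofReal
    have hAn : Measurable fun ω => A ω * ENNReal.ofReal (p.normalizer (B ω))⁻¹ := hAm.mul hnm
    have hAw : ∀ j, Measurable fun ω => A ω * ENNReal.ofReal (p.weight (B ω) j) := fun j =>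
      hAm.mul (hwm j)
    have step : ∀ ω, ENNReal.ofReal (noiseGrowth p D ω T ^ κ) ≤
        ENNReal.ofReal (p.normalizer (B ω))⁻¹ + ∑ j : Fin m, ENNReal.ofReal (p.weight (B ω) j) *
          ENNReal.ofReal (Real.exp (θ * logit (ω (T * m + j)))) := by
      intro ω
      have h1 := p.normalizer_div_rpow_le (B ω) (fun j => p.noiseScale * logit (ω (T * m + j))) hκ
      have h2 : (fun j => B ω j + p.noiseScale * logit (ω (T * m + j))) =
          dualState p D ω (T + 1) := by
        ext j
        simp only [hB, Params.noiseless, Params.excess, dualState]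
        ring
      rw [h2] at h1
      refine (ENNReal.ofReal_le_ofReal h1).trans (le_of_eq ?_)
      have hw := fun j => p.weight_nonneg (B ω) j
      rw [ENNReal.ofReal_add (inv_pos.2 (p.normalizer_pos _)).le
        (Finset.sum_nonneg fun j _ => mul_nonneg (hw j) (Real.exp_pos _).le),
        ENNReal.ofReal_sum_of_nonneg fun j _ => mul_nonneg (hw j) (Real.exp_pos _).le]
      congr 1
      refine Finset.sum_congr rfl fun j _ => ?_
      rw [ENNReal.ofReal_mul (hw j), hθdef]
      congr 3
      ring
    calc ∫⁻ ω, ∏ t ∈ Finset.range (T + 1), ENNReal.ofReal (noiseGrowth p D ω t ^ κ) ∂coins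
        ≤ ∫⁻ ω, (A ω * ENNReal.ofReal (p.normalizer (B ω))⁻¹ +
            ∑ j : Fin m, (A ω * ENNReal.ofReal (p.weight (B ω) j)) *
              ENNReal.ofReal (Real.exp (θ * logit (ω (T * m + j))))) ∂coins := by
          refine lintegral_mono fun ω => ?_
          dsimp only
          rw [Finset.prod_range_succ]
          refine (mul_le_mul_right (step ω) _).trans (le_of_eq ?_)
          rw [mul_add, Finset.mul_sum]
          simp only [mul_assoc]
          rfl
      _ = ∫⁻ ω, A ω * ENNReal.ofReal (p.normalizer (B ω))⁻¹ ∂coins +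
            ∑ j : Fin m, (∫⁻ ω, A ω * ENNReal.ofReal (p.weight (B ω) j) ∂coins) *
              ∫⁻ u, ENNReal.ofReal (Real.exp (θ * logit u)) := by
          rw [lintegral_add_left hAn, lintegral_finsetSum _ (fun j _ => by
            have := hAw j
            fun_prop)]
          congr 1
          refine Finset.sum_congr rfl fun j _ => ?_
          exact lintegral_mul_fresh (i := T * m + j) (hAw j)
            (fun ω u => by rw [hAu, hBu])
            (φ := fun u => ENNReal.ofReal (Real.exp (θ * logit u))) (by fun_prop)
      _ ≤ (∫⁻ ω, A ω * ENNReal.ofReal (p.normalizer (B ω))⁻¹ ∂coins) * E +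
            ∑ j : Fin m, (∫⁻ ω, A ω * ENNReal.ofReal (p.weight (B ω) j) ∂coins) * E := by
          gcongr
          · exact le_mul_of_one_le_right zero_le hE1
          · exact lintegral_exp_logit_le hθ
      _ = (∫⁻ ω, A ω ∂coins) * E := by
          rw [← Finset.sum_mul, ← add_mul, ← lintegral_finsetSum _ (fun j _ => hAw j),
            ← lintegral_add_left hAn]
          congr 1
          refine lintegral_congr fun ω => ?_
          rw [← Finset.mul_sum, ← mul_add,
            ← ENNReal.ofReal_sum_of_nonneg fun j _ => p.weight_nonneg (B ω) j,
            ← ENNReal.ofReal_add (inv_pos.2 (p.normalizer_pos _)).le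
              (Finset.sum_nonneg fun j _ => p.weight_nonneg (B ω) j),
            p.inv_normalizer_add_sum_weight, ENNReal.ofReal_one, mul_one]
      _ ≤ E ^ (T + 1) := by
          rw [pow_succ]
          gcongr

theorem lintegral_exp_sum_logit_le {θ : ℝ} (hθ : |θ| ≤ 1 / 2) (j : Fin m) (T : ℕ) :
    ∫⁻ ω : ℕ → unitInterval, ENNReal.ofReal
      (Real.exp (θ * ∑ t ∈ Finset.range T, logit (ω (t * m + j)))) ∂coins ≤
      ENNReal.ofReal (Real.exp (8 * θ ^ 2)) ^ T := by
  have hl := measurable_logit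
  induction T with
  | zero => simp
  | succ T ih =>
    have h1 : ∀ ω : ℕ → unitInterval, ENNReal.ofReal
        (Real.exp (θ * ∑ t ∈ Finset.range (T + 1), logit (ω (t * m + j)))) =
        ENNReal.ofReal (Real.exp (θ * ∑ t ∈ Finset.range T, logit (ω (t * m + j)))) *
          ENNReal.ofReal (Real.exp (θ * logit (ω (T * m + j)))) := by
      intro ω
      rw [Finset.sum_range_succ, mul_add, Real.exp_add, ENNReal.ofReal_mul (Real.exp_pos _).le]
    simp only [h1]
    rw [lintegral_mul_fresh (i := T * m + j)
      (F := fun ω => ENNReal.ofReal (Real.exp (θ * ∑ t ∈ Finset.range T, logit (ω (t * m + j)))))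
      (by fun_prop) ?_ (φ := fun u => ENNReal.ofReal (Real.exp (θ * logit u))) (by fun_prop),
      pow_succ]
    · exact mul_le_mul' ih (lintegral_exp_logit_le hθ)
    · intro ω u
      have : ∀ t ∈ Finset.range T, logit (Function.update ω (T * m + j) u (t * m + j)) =
          logit (ω (t * m + j)) := by
        intro t ht
        have h : (t + 1) * m ≤ T * m := Nat.mul_le_mul_right m (Finset.mem_range.1 ht)
        have h' : (t + 1) * m = t * m + m := by ring
        have hj := j.2
        rw [Function.update_of_ne (by omega)]
      simp only [Finset.sum_congr rfl this]

theorem coins_exp_le {F : (ℕ → unitInterval) → ℝ} (hF : Measurable F) {c β : ℝ} (hβ : 0 < β)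
    (h : ∫⁻ ω, ENNReal.ofReal (Real.exp (F ω)) ∂coins ≤ ENNReal.ofReal (Real.exp c)) :
    coins {ω | c + Real.log (1 / β) ≤ F ω} ≤ ENNReal.ofReal β := by
  have e : {ω | c + Real.log (1 / β) ≤ F ω} = {ω | ENNReal.ofReal
      (Real.exp (c + Real.log (1 / β))) ≤ ENNReal.ofReal (Real.exp (F ω))} := by
    ext ω
    simp [ENNReal.ofReal_le_ofReal_iff, (Real.exp_pos _).le]
  rw [e]
  refine (meas_ge_le_lintegral_div (by fun_prop) (by simp [Real.exp_pos]) (by simp)).trans ?_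
  refine (ENNReal.div_le_div_right h _).trans ?_
  rw [← ENNReal.ofReal_div_of_pos (Real.exp_pos _), ← Real.exp_sub]
  refine ENNReal.ofReal_le_ofReal ?_
  rw [show c - (c + Real.log (1 / β)) = Real.log β by rw [one_div, Real.log_inv]; ring,
    Real.exp_log hβ]

end Noise

end PrivatePacking

/-! ### Accuracy -/

namespace PrivatePacking

open RealRAM

namespace Params

variable {n m : ℕ} {p : Params n m}

/-- The value of an allocation when the base prices of the demands are subtracted. -/
noncomputable def netValue (p : Params n m) (D : Dataset n m) (x : Fin n → ℝ) : ℝ :=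
  ∑ i, (((D i).value : ℝ) - p.base * ∑ j, ((D i).demand j : ℝ)) * x i

/-- The consumption of a resource by an allocation. -/
noncomputable def usage (D : Dataset n m) (x : Fin n → ℝ) (j : Fin m) : ℝ :=
  ∑ i, ((D i).demand j : ℝ) * x i

theorem netValue_eq (p : Params n m) (D : Dataset n m) (x : Fin n → ℝ) :
    p.netValue D x = objective D x - p.base * ∑ j, usage D x j := by
  simp only [netValue, objective, usage]
  rw [Finset.sum_comm, Finset.mul_sum, ← Finset.sum_sub_distrib]
  refine Finset.sum_congr rfl fun i _ => ?_
  rw [← Finset.sum_mul]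
  ring

/-- The best responses maximise the Lagrangian, which is the net value minus the payments for the
weights. -/
theorem lagrangian_le (p : Params n m) (D : Dataset n m) (S : Fin m → ℝ) {y : Fin n → ℝ}
    (hy : ∀ i, 0 ≤ y i ∧ y i ≤ 1) :
    p.netValue D y - p.cap * ∑ j, p.weight S j * usage D y j ≤
      p.netValue D (fun i => p.buys S (D i)) - p.cap * ∑ j, p.weight S j * p.load D S j := by
  have key : ∀ x : Fin n → ℝ, p.netValue D x - p.cap * ∑ j, p.weight S j * usage D x j =
      ∑ i, (((D i).value : ℝ) - ∑ j, ((D i).demand j : ℝ) * p.price S j) * x i := by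
    intro x
    simp only [netValue, usage, Finset.mul_sum]
    rw [Finset.sum_comm, ← Finset.sum_sub_distrib]
    refine Finset.sum_congr rfl fun i _ => ?_
    rw [sub_mul, sub_mul, Finset.sum_mul, Finset.sum_mul, sub_sub, ← Finset.sum_add_distrib]
    congr 1
    refine Finset.sum_congr rfl fun j _ => ?_
    rw [price]
    ring
  have h2 := key (fun i => p.buys S (D i))
  change _ - p.cap * ∑ j, p.weight S j * p.load D S j = _ at h2
  rw [h2, key y]
  refine Finset.sum_le_sum fun i _ => ?_
  unfold buys
  split_ifs with h
  · nlinarith [(hy i).2]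
  · nlinarith [(hy i).1]

theorem usage_smul (D : Dataset n m) (c : ℝ) (x : Fin n → ℝ) (j : Fin m) :
    usage D (fun i => c * x i) j = c * usage D x j := by
  simp only [usage, Finset.mul_sum]
  exact Finset.sum_congr rfl fun i _ => by ring

theorem netValue_smul (p : Params n m) (D : Dataset n m) (c : ℝ) (x : Fin n → ℝ) :
    p.netValue D (fun i => c * x i) = c * p.netValue D x := by
  simp only [netValue, Finset.mul_sum]
  exact Finset.sum_congr rfl fun i _ => by ring

theorem objective_le (D : Dataset n m) {x : Fin n → ℝ} (hx : ∀ i, 0 ≤ x i ∧ x i ≤ 1) :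
    objective D x ≤ n := by
  calc objective D x ≤ ∑ _i : Fin n, (1 : ℝ) := Finset.sum_le_sum fun i _ =>
        mul_le_one₀ (D i).value.2.2 (hx i).1 (hx i).2
    _ = n := by simp

theorem usage_nonneg (D : Dataset n m) {x : Fin n → ℝ} (hx : ∀ i, 0 ≤ x i ∧ x i ≤ 1) (j : Fin m) :
    0 ≤ usage D x j :=
  Finset.sum_nonneg fun i _ => mul_nonneg ((D i).demand j).2.1 (hx i).1

theorem Valid.netValue_le_objective (hp : p.Valid) (D : Dataset n m) {x : Fin n → ℝ}
    (hx : ∀ i, 0 ≤ x i ∧ x i ≤ 1) : p.netValue D x ≤ objective D x := by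
  rw [netValue_eq]
  have := mul_nonneg hp.base_pos.le
    (Finset.sum_nonneg fun j (_ : j ∈ Finset.univ) => usage_nonneg D hx j)
  linarith

/-- The multiplicative weights bound compares `x` with every `y` that respects the reduced supply.
It is used twice: in `h₁` because the potential is nonnegative, and in `h₂` because the potential
dominates the violation of each constraint. Together they make `x` feasible and nearly optimal. -/
theorem Valid.isNearOptimal (hp : p.Valid) (D : Dataset n m) {x : Fin n → ℝ}
    (hx : ∀ i, 0 ≤ x i ∧ x i ≤ 1)
    (h₁ : ∀ y : Fin n → ℝ, (∀ i, 0 ≤ y i ∧ y i ≤ 1) → (∀ j, usage D y j ≤ p.target) →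
      0 ≤ (p.netValue D x - p.netValue D y) / p.cap + p.α * p.b / 16)
    (h₂ : ∀ y : Fin n → ℝ, (∀ i, 0 ≤ y i ∧ y i ≤ 1) → (∀ j, usage D y j ≤ p.target) → ∀ j,
      usage D x j - p.target ≤ (p.netValue D x - p.netValue D y) / p.cap + p.α * p.b / 8) :
    IsNearOptimal D p.b (p.α * n) x := by
  have hα := hp.α_pos
  have hα1 := hp.α_lt
  have hb := hp.b_pos
  have hn := hp.n_pos'
  have hm := hp.m_pos'
  have hαb : 0 < p.α * p.b := by positivity
  have ht := hp.target_pos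
  have htb := hp.target_le
  have hcap : ∀ r : ℝ, r / p.cap = r * p.b / (4 * n) := fun r => by
    unfold cap
    field_simp
  have target_eq : p.target = p.b - p.α * p.b / 4 := rfl
  refine ⟨⟨hx, ?_⟩, ?_⟩
  · by_contra! hj
    obtain ⟨j₀, hj₀⟩ := hj
    obtain ⟨j, -, hj⟩ := Finset.exists_max_image Finset.univ (fun j => usage D x j)
      ⟨j₀, Finset.mem_univ _⟩
    have hbig : p.b < usage D x j := hj₀.trans_le (hj j₀ (Finset.mem_univ _))
    set L := usage D x j with hL
    have hL0 : 0 < L := hb.trans hbig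
    have hc0 : 0 ≤ p.target / L := by positivity
    have hc1 : p.target / L ≤ 1 := (div_le_one hL0).2 (by linarith)
    -- the multiple of `x` that just meets the reduced supply of the most used resource
    have h := h₂ (fun i => p.target / L * x i)
      (fun i => ⟨mul_nonneg hc0 (hx i).1, mul_le_one₀ hc1 (hx i).1 (hx i).2⟩)
      (fun k => by
        rw [usage_smul, div_mul_eq_mul_div, div_le_iff₀ hL0]
        exact mul_le_mul_of_nonneg_left (hj k (Finset.mem_univ _)) ht.le) j
    have hnet : p.netValue D x ≤ n := (hp.netValue_le_objective D hx).trans (objective_le D hx)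
    rw [netValue_smul, hcap, ← hL] at h
    have e1 : p.netValue D x - p.target / L * p.netValue D x =
        (1 - p.target / L) * p.netValue D x := by ring
    have e2 : (1 - p.target / L) * p.netValue D x * p.b / (4 * n) ≤ (L - p.target) / 4 := by
      have h3 : (1 - p.target / L) * p.netValue D x ≤ (1 - p.target / L) * n :=
        mul_le_mul_of_nonneg_left hnet (by linarith)
      calc (1 - p.target / L) * p.netValue D x * p.b / (4 * n)
          ≤ (1 - p.target / L) * n * p.b / (4 * n) := by gcongr
        _ = (1 - p.target / L) * p.b / 4 := by field_simp
        _ ≤ (1 - p.target / L) * L / 4 := by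
            have : 0 ≤ 1 - p.target / L := by linarith
            gcongr
        _ = (L - p.target) / 4 := by field_simp
    rw [e1] at h
    linarith
  · intro y hy
    have hc0 : 0 ≤ 1 - p.α / 4 := by linarith
    have hc1 : 1 - p.α / 4 ≤ 1 := by linarith
    have hyu : ∀ j, usage D y j ≤ p.b := hy.2
    -- a feasible `y` is scaled down to respect the reduced supply
    have h := h₁ (fun i => (1 - p.α / 4) * y i)
      (fun i => ⟨mul_nonneg hc0 (hy.1 i).1, mul_le_one₀ hc1 (hy.1 i).1 (hy.1 i).2⟩)
      (fun j => by
        rw [usage_smul, target_eq]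
        nlinarith [hyu j])
    rw [netValue_smul, hcap] at h
    have h3 : 0 ≤ p.netValue D x - (1 - p.α / 4) * p.netValue D y + p.α * n / 4 := by
      have h4 := mul_nonneg h (by positivity : 0 ≤ 4 * n / p.b)
      calc (0 : ℝ) ≤ _ := h4
        _ = _ := by field_simp; ring
    have h5 : p.netValue D y ≥ objective D y - p.α * n / 4 := by
      rw [netValue_eq]
      have h6 : ∑ j, usage D y j ≤ m * p.b := by
        calc ∑ j, usage D y j ≤ ∑ _j : Fin m, p.b := Finset.sum_le_sum fun j _ => hyu j
          _ = m * p.b := by simp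
      have h7 := mul_le_mul_of_nonneg_left h6 hp.base_pos.le
      have h8 : p.base * (m * p.b) = p.α * n / 4 := by
        unfold base
        field_simp
      linarith
    have h6 := hp.netValue_le_objective D hx
    have h7 := objective_le D hy.1
    nlinarith [mul_le_mul_of_nonneg_left h5 hc0, mul_nonneg hα.le hn.le,
      mul_nonneg (mul_nonneg hα.le hα.le) hn.le, mul_le_mul_of_nonneg_left h7 hα.le]

/-- The supply is large enough for the failure probability `β`: conditions under which the power
`exponent` is at least `1`, and each error term is at most a fixed fraction of `α * b`. -/
structure LargeSupply (p : Params n m) (β : ℝ) : Prop where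
  rounds : 64 * √m * p.logFactor ≤ p.ε * (p.α * p.b)
  deviation : 64 * √m * Real.log (2 / β) ≤ p.ε * (p.α * p.b)
  variance : 2048 * √m * p.logFactor ^ 2 ≤ p.ε * (p.α * p.b)
  noise : 32 * √m * p.logFactor * (8 + Real.log (2 * m / β)) ≤ p.ε * (p.α * p.b)

/-- The power of the normaliser whose growth is controlled by a supermartingale. A larger power
gives a smaller deviation; this one makes its product with the learning rate and the noise scale
equal to `2 * logFactor / side`, which is below `1 / 2`, as the moments of the noise require. -/
noncomputable def exponent (p : Params n m) : ℝ := p.ε * (p.α * p.b) / (64 * √m * p.logFactor)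

theorem Valid.sqrt_m_pos (hp : p.Valid) : 0 < √(m : ℝ) := Real.sqrt_pos.2 hp.m_pos'

theorem Valid.exponent_mul_rate_mul_noiseScale (hp : p.Valid) :
    p.exponent * p.rate * p.noiseScale = 2 * p.logFactor / p.side := by
  have := hp.α_pos
  have := hp.b_pos
  have := hp.side_pos
  have := hp.logFactor_pos
  have := hp.ε_pos
  have := hp.sqrt_m_pos
  rw [exponent, rate, noiseScale, rounds]
  field_simp

theorem Valid.le_side' (hp : p.Valid) : 256 * p.logFactor * m ≤ p.side * (p.α * p.α) := by
  have h := p.le_side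
  have := hp.α_pos
  rwa [div_le_iff₀ (by positivity)] at h

theorem Valid.logFactor_le_side (hp : p.Valid) : 256 * p.logFactor ≤ p.side := by
  have h := hp.le_side'
  have hm : (1 : ℝ) ≤ m := by exact_mod_cast hp.m_pos
  have := hp.logFactor_pos
  have h1 : p.α * p.α ≤ 1 := by nlinarith [hp.α_pos, hp.α_lt]
  have := hp.side_pos
  nlinarith

theorem Valid.rate_mul_rounds (hp : p.Valid) :
    p.rate * p.rounds = 64 * p.logFactor / (p.α * p.b) := by
  have := hp.rounds_pos
  have := hp.α_pos
  have := hp.b_pos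
  rw [rate]
  field_simp

theorem Valid.rate_mul_width_le (hp : p.Valid) : p.rate * p.width ≤ 1 / p.side := by
  have h := hp.le_side'
  have := hp.α_pos
  have := hp.b_pos
  have := hp.side_pos
  have : p.rate * p.width = 256 * p.logFactor * m / (p.α * p.α) / (p.side * p.side) := by
    rw [rate, width, rounds]
    field_simp
    ring
  rw [this, div_le_div_iff₀ (by positivity) (by positivity), one_mul]
  gcongr
  exact p.le_side

end Params

section Accuracy

variable {n m : ℕ} {p : Params n m}

theorem buys_average_mem (hp : p.Valid) (S : ℕ → Fin m → ℝ) (A : Agent m) :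
    0 ≤ ∑ t ∈ Finset.range (p.side * p.side), p.buys (S t) A / p.rounds ∧
      ∑ t ∈ Finset.range (p.side * p.side), p.buys (S t) A / p.rounds ≤ 1 := by
  have hr := hp.rounds_pos
  refine ⟨Finset.sum_nonneg fun t _ => div_nonneg (Params.buys_nonneg _ _) hr.le, ?_⟩
  rw [← Finset.sum_div, div_le_one hr]
  calc ∑ t ∈ Finset.range (p.side * p.side), p.buys (S t) A
      ≤ ∑ _t ∈ Finset.range (p.side * p.side), (1 : ℝ) :=
        Finset.sum_le_sum fun t _ => Params.buys_le_one _ _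
    _ = p.rounds := by simp [Params.rounds]

theorem output_mem (hp : p.Valid) (D : Dataset n m) (ω : ℕ → unitInterval) (i : Fin n) :
    0 ≤ output p D ω i ∧ output p D ω i ≤ 1 :=
  buys_average_mem hp (dualState p D ω) (D i)

theorem sum_netValue_eq (hp : p.Valid) (D : Dataset n m) (ω : ℕ → unitInterval) :
    ∑ t ∈ Finset.range (p.side * p.side),
      p.netValue D (fun i => p.buys (dualState p D ω t) (D i)) =
      p.rounds * p.netValue D (output p D ω) := by
  have hr := hp.rounds_pos.ne'
  simp only [Params.netValue, output]
  rw [Finset.sum_comm, Finset.mul_sum]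
  refine Finset.sum_congr rfl fun i _ => ?_
  rw [← Finset.mul_sum, ← Finset.sum_div]
  field_simp

theorem sum_load_eq (hp : p.Valid) (D : Dataset n m) (ω : ℕ → unitInterval) (j : Fin m) :
    ∑ t ∈ Finset.range (p.side * p.side), p.load D (dualState p D ω t) j =
      p.rounds * Params.usage D (output p D ω) j := by
  have hr := hp.rounds_pos.ne'
  simp only [Params.load, Params.usage, output]
  rw [Finset.sum_comm, Finset.mul_sum]
  refine Finset.sum_congr rfl fun i _ => ?_
  rw [← Finset.mul_sum, ← Finset.sum_div]
  field_simp

theorem dualState_apply (D : Dataset n m) (ω : ℕ → unitInterval) (T : ℕ) (j : Fin m) :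
    dualState p D ω T j = ∑ t ∈ Finset.range T, p.load D (dualState p D ω t) j - T * p.target +
      p.noiseScale * ∑ t ∈ Finset.range T, logit (ω (t * m + j)) := by
  induction T with
  | zero => simp [dualState]
  | succ T ih =>
    simp only [dualState]
    rw [ih, Finset.sum_range_succ, Finset.sum_range_succ]
    push_cast
    ring

/-- The growth of the potential over the rounds. -/
theorem log_normalizer_dualState_le (hp : p.Valid) (D : Dataset n m) (ω : ℕ → unitInterval)
    (T : ℕ) :
    Real.log (p.normalizer (dualState p D ω T)) ≤ Real.log (m + 1) +
      p.rate * ∑ t ∈ Finset.range T, ∑ j, p.weight (dualState p D ω t) j *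
        p.excess D (dualState p D ω t) j + T * (p.rate * p.width) ^ 2 +
      ∑ t ∈ Finset.range T, Real.log (noiseGrowth p D ω t) := by
  have hw : p.rate * p.width ≤ 1 := by
    refine hp.rate_mul_width_le.trans ?_
    rw [div_le_one hp.side_pos]
    linarith [hp.logFactor_le_side, hp.one_le_logFactor]
  induction T with
  | zero =>
    simp [dualState, Params.normalizer, add_comm]
  | succ T ih =>
    have h1 := hp.log_normalizer_noiseless_le D (dualState p D ω T) hw
    have h2 : Real.log (noiseGrowth p D ω T) = _ :=
      Real.log_div (p.normalizer_pos _).ne' (p.normalizer_pos _).ne'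
    rw [Finset.sum_range_succ, Finset.sum_range_succ, h2]
    push_cast
    linarith

/-- If the noise behaves typically, then the allocation is feasible and nearly optimal. -/
theorem output_isNearOptimal (hp : p.Valid) {β : ℝ} (hs : p.LargeSupply β) (D : Dataset n m)
    (ω : ℕ → unitInterval)
    (hgrowth : p.exponent *
      ∑ t ∈ Finset.range (p.side * p.side), Real.log (noiseGrowth p D ω t) ≤
        32 * p.logFactor ^ 2 + Real.log (2 / β))
    (hnoise : ∀ j : Fin m, -∑ t ∈ Finset.range (p.side * p.side), logit (ω (t * m + j)) ≤
      p.side * (8 + Real.log (2 * m / β))) :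
    IsNearOptimal D p.b (p.α * n) (output p D ω) := by
  set T := p.side * p.side with hT
  have hTr : (T : ℝ) = p.rounds := by simp [hT, Params.rounds]
  set x := output p D ω with hx
  have hα := hp.α_pos
  have hb := hp.b_pos
  have hε := hp.ε_pos
  have hG := hp.one_le_logFactor
  have hG0 := hp.logFactor_pos
  have hr := hp.rounds_pos
  have hη := hp.rate_pos
  have hm := hp.sqrt_m_pos
  have hside := hp.side_pos
  have hcap := hp.cap_pos
  have hκ : 0 < p.exponent := by
    unfold Params.exponent
    positivity
  have hηT := hp.rate_mul_rounds
  have hηT16 : p.rate * p.rounds * (p.α * p.b / 16) = 4 * p.logFactor := by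
    rw [hηT]
    field_simp
    norm_num
  -- each of the four error terms is at most the logarithmic factor
  have err : Real.log (m + 1) + T * (p.rate * p.width) ^ 2 +
      ∑ t ∈ Finset.range T, Real.log (noiseGrowth p D ω t) ≤
        p.rate * p.rounds * (p.α * p.b / 16) := by
    have t1 : Real.log (m + 1) ≤ p.logFactor := by
      rw [hp.logFactor_eq]
      linarith [hp.log_inv_δ_nonneg]
    have t2 : T * (p.rate * p.width) ^ 2 ≤ p.logFactor := by
      refine le_trans ?_ hG
      have h0 : 0 ≤ p.rate * p.width := (mul_pos hη hp.width_pos).le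
      calc T * (p.rate * p.width) ^ 2 ≤ T * (1 / (p.side : ℝ)) ^ 2 := by
            gcongr
            exact hp.rate_mul_width_le
        _ = 1 := by
            rw [hTr, Params.rounds]
            field_simp
    have t3 : ∑ t ∈ Finset.range T, Real.log (noiseGrowth p D ω t) ≤ 2 * p.logFactor := by
      have h1 : 32 * p.logFactor ^ 2 ≤ p.exponent * p.logFactor := by
        rw [Params.exponent, div_mul_eq_mul_div, le_div_iff₀ (by positivity)]
        nlinarith [hs.variance]
      have h2 : Real.log (2 / β) ≤ p.exponent * p.logFactor := by
        rw [Params.exponent, div_mul_eq_mul_div, le_div_iff₀ (by positivity)]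
        nlinarith [hs.deviation]
      refine le_of_mul_le_mul_left ?_ hκ
      linarith
    linarith
  -- the payments for the excess load are covered by the gain in net value
  have pay : ∀ y : Fin n → ℝ, (∀ i, 0 ≤ y i ∧ y i ≤ 1) → (∀ j, Params.usage D y j ≤ p.target) →
      ∑ t ∈ Finset.range T, ∑ j, p.weight (dualState p D ω t) j *
        p.excess D (dualState p D ω t) j ≤
          p.rounds * ((p.netValue D x - p.netValue D y) / p.cap) := by
    intro y hy hyu
    have h1 : ∀ t ∈ Finset.range T, ∑ j, p.weight (dualState p D ω t) j *
        p.excess D (dualState p D ω t) j ≤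
        (p.netValue D (fun i => p.buys (dualState p D ω t) (D i)) - p.netValue D y) / p.cap := by
      intro t _
      rw [le_div_iff₀ hcap]
      have h2 := p.lagrangian_le D (dualState p D ω t) hy
      have h3 : ∑ j, p.weight (dualState p D ω t) j * p.excess D (dualState p D ω t) j ≤
          ∑ j, p.weight (dualState p D ω t) j * p.load D (dualState p D ω t) j -
            ∑ j, p.weight (dualState p D ω t) j * Params.usage D y j := by
        rw [← Finset.sum_sub_distrib]
        refine Finset.sum_le_sum fun j _ => ?_
        rw [Params.excess, ← mul_sub]
        exact mul_le_mul_of_nonneg_left (by linarith [hyu j]) (p.weight_nonneg _ j)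
      have h4 := mul_le_mul_of_nonneg_left h3 hcap.le
      linarith
    refine (Finset.sum_le_sum h1).trans (le_of_eq ?_)
    rw [← Finset.sum_div, Finset.sum_sub_distrib, sum_netValue_eq hp D ω, Finset.sum_const,
      Finset.card_range, nsmul_eq_mul, hTr]
    ring
  have pot : ∀ y : Fin n → ℝ, (∀ i, 0 ≤ y i ∧ y i ≤ 1) → (∀ j, Params.usage D y j ≤ p.target) →
      Real.log (p.normalizer (dualState p D ω T)) ≤ p.rate * p.rounds *
        ((p.netValue D x - p.netValue D y) / p.cap + p.α * p.b / 16) := by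
    intro y hy hyu
    have h1 := log_normalizer_dualState_le hp D ω T
    have h2 := mul_le_mul_of_nonneg_left (pay y hy hyu) hη.le
    linarith
  refine hp.isNearOptimal D (fun i => output_mem hp D ω i) ?_ ?_
  · intro y hy hyu
    have h1 := Real.log_nonneg (p.one_le_normalizer (dualState p D ω T))
    exact nonneg_of_mul_nonneg_right (h1.trans (pot y hy hyu)) (mul_pos hη hr)
  · intro y hy hyu j
    have h1 : p.rate * dualState p D ω T j ≤ Real.log (p.normalizer (dualState p D ω T)) := by
      rw [Real.le_log_iff_exp_le (p.normalizer_pos _)]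
      exact p.exp_le_normalizer _ j
    have h2 := h1.trans (pot y hy hyu)
    rw [mul_assoc] at h2
    have h3 := le_of_mul_le_mul_left h2 hη
    rw [dualState_apply, sum_load_eq hp, hTr] at h3
    have h4 := mul_le_mul_of_nonneg_left (hnoise j) hp.noiseScale_pos.le
    have h5 : p.noiseScale * (p.side * (8 + Real.log (2 * m / β))) ≤
        p.rounds * (p.α * p.b / 16) := by
      have e : p.noiseScale * (p.side * (8 + Real.log (2 * m / β))) =
          p.rounds * (32 * √m * p.logFactor * (8 + Real.log (2 * m / β)) / (16 * p.ε)) := by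
        rw [Params.noiseScale, Params.rounds]
        field_simp
        ring
      rw [e]
      refine mul_le_mul_of_nonneg_left ?_ hr.le
      rw [div_le_div_iff₀ (by positivity) (by norm_num)]
      nlinarith [hs.noise]
    refine le_of_mul_le_mul_left ?_ hr
    linarith

/-- The failure probability: half of `β` is spent on the growth of the potential, and the other half
on the total noise of each resource. -/
theorem coins_not_isNearOptimal_le (hp : p.Valid) {β : ℝ} (hβ : 0 < β) (hs : p.LargeSupply β)
    (D : Dataset n m) :
    coins {ω | ¬ IsNearOptimal D p.b (p.α * n) (output p D ω)} ≤ ENNReal.ofReal β := by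
  set T := p.side * p.side with hT
  have hm0 := hp.m_pos'
  have hside := hp.side_pos
  have hG0 := hp.logFactor_pos
  have hm := hp.sqrt_m_pos
  have hGs := hp.logFactor_le_side
  have hG := hp.one_le_logFactor
  have hTs : (T : ℝ) = p.side * p.side := by simp [hT]
  set F : (ℕ → unitInterval) → ℝ := fun ω =>
    p.exponent * ∑ t ∈ Finset.range T, Real.log (noiseGrowth p D ω t) with hF
  set N : Fin m → (ℕ → unitInterval) → ℝ := fun j ω =>
    -(1 / (p.side : ℝ)) * ∑ t ∈ Finset.range T, logit (ω (t * m + j)) with hN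
  have hFm : Measurable F := by
    have := fun t => measurable_noiseGrowth (p := p) D t
    fun_prop
  have hNm : ∀ j, Measurable (N j) := by
    intro j
    have := measurable_logit
    fun_prop
  have hκ1 : 1 ≤ p.exponent := by
    rw [Params.exponent, one_le_div (by positivity)]
    exact hs.rounds
  have hθ := hp.exponent_mul_rate_mul_noiseScale
  have bF : coins {ω | 32 * p.logFactor ^ 2 + Real.log (1 / (β / 2)) ≤ F ω} ≤
      ENNReal.ofReal (β / 2) := by
    refine coins_exp_le hFm (by positivity) ?_
    have h := lintegral_prod_noiseGrowth_le D hκ1 (p := p) (by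
      rw [hθ, abs_of_pos (by positivity), div_le_div_iff₀ hside (by norm_num)]
      linarith) T
    have e1 : ∀ ω, ENNReal.ofReal (Real.exp (F ω)) =
        ∏ t ∈ Finset.range T, ENNReal.ofReal (noiseGrowth p D ω t ^ p.exponent) := by
      intro ω
      rw [← ENNReal.ofReal_prod_of_nonneg fun t _ =>
        Real.rpow_nonneg (noiseGrowth_pos D ω t).le _, hF]
      dsimp only
      rw [Finset.mul_sum, Real.exp_sum]
      congr 1
      refine Finset.prod_congr rfl fun t _ => ?_
      rw [Real.rpow_def_of_pos (noiseGrowth_pos D ω t), mul_comm]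
    simp only [e1]
    refine h.trans (le_of_eq ?_)
    rw [← ENNReal.ofReal_pow (Real.exp_pos _).le, ← Real.exp_nat_mul, hθ, hTs]
    congr 2
    field_simp
    ring
  have bN : ∀ j, coins {ω | 8 + Real.log (1 / (β / (2 * m))) ≤ N j ω} ≤
      ENNReal.ofReal (β / (2 * m)) := by
    intro j
    refine coins_exp_le (hNm j) (by positivity) ?_
    have h := lintegral_exp_sum_logit_le (θ := -(1 / (p.side : ℝ))) (by
      rw [abs_neg, abs_of_pos (by positivity), div_le_div_iff₀ hside (by norm_num)]
      linarith) j T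
    refine h.trans (le_of_eq ?_)
    rw [← ENNReal.ofReal_pow (Real.exp_pos _).le, ← Real.exp_nat_mul, hTs]
    congr 2
    field_simp
  have sub : {ω | ¬ IsNearOptimal D p.b (p.α * n) (output p D ω)} ⊆
      {ω | 32 * p.logFactor ^ 2 + Real.log (1 / (β / 2)) ≤ F ω} ∪
        ⋃ j, {ω | 8 + Real.log (1 / (β / (2 * m))) ≤ N j ω} := by
    intro ω hω
    by_contra hc
    simp only [Set.mem_union, Set.mem_iUnion, Set.mem_ofPred_eq, not_or, not_exists, not_le] at hc
    obtain ⟨hc1, hc2⟩ := hc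
    rw [one_div_div] at hc1
    refine hω (output_isNearOptimal hp hs D ω hc1.le fun j => ?_)
    have h := hc2 j
    rw [one_div_div] at h
    have h' := mul_le_mul_of_nonneg_left h.le hside.le
    refine le_trans (le_of_eq ?_) h'
    rw [hN]
    dsimp only
    field_simp
    rfl
  refine (measure_mono sub).trans ((measure_union_le _ _).trans ?_)
  refine (add_le_add bF ((measure_iUnion_fintype_le _ _).trans
    (Finset.sum_le_sum fun j _ => bN j))).trans (le_of_eq ?_)
  rw [Finset.sum_const, Finset.card_univ, Fintype.card_fin, nsmul_eq_mul,
    ← ENNReal.ofReal_natCast, ← ENNReal.ofReal_mul (by positivity),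
    ← ENNReal.ofReal_add (by positivity) (by positivity)]
  congr 1
  field_simp
  ring

/-- All logarithmic factors are dominated by `ln (m + 1 / α + 1 / δ + 1 / β)`. -/
theorem largeSupply_of_le (hp : p.Valid) {β : ℝ} (hβ : 0 < β) (hβ1 : β < 1)
    (h : 20000 * (√m / (p.α * p.ε)) *
      Real.log (m + 1 / p.α + 1 / p.δ + 1 / β) ^ 2 ≤ p.b) : p.LargeSupply β := by
  have hα := hp.α_pos
  have hδ := hp.δ_pos
  have hε := hp.ε_pos
  have hm := hp.sqrt_m_pos
  have hm0 := hp.m_pos'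
  have hm1 : (1 : ℝ) ≤ m := by exact_mod_cast hp.m_pos
  have hα' : 1 ≤ 1 / p.α := by
    rw [le_div_iff₀ hα, one_mul]
    exact hp.α_lt.le
  have hδ' : 1 ≤ 1 / p.δ := by
    rw [le_div_iff₀ hδ, one_mul]
    exact hp.δ_lt.le
  have hβ' : 1 ≤ 1 / β := by
    rw [le_div_iff₀ hβ, one_mul]
    exact hβ1.le
  set Λ := Real.log (m + 1 / p.α + 1 / p.δ + 1 / β) with hΛ
  have l1 : 1 ≤ Λ := by
    rw [hΛ, Real.le_log_iff_exp_le (by positivity)]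
    linarith [Real.exp_one_lt_d9]
  have lm : Real.log (m + 1) ≤ Λ := Real.log_le_log (by positivity) (by linarith)
  have lδ : Real.log (1 / p.δ) ≤ Λ := Real.log_le_log (by positivity) (by linarith)
  have lβ : Real.log (1 / β) ≤ Λ := Real.log_le_log (by positivity) (by linarith)
  have lm' : Real.log m ≤ Λ := Real.log_le_log (by positivity) (by linarith)
  have l2 : Real.log 2 ≤ 1 := by linarith [Real.log_two_lt_d9]
  have lG : p.logFactor ≤ 3 * Λ := by
    rw [hp.logFactor_eq]
    linarith
  have lβ2 : Real.log (2 / β) ≤ 2 * Λ := by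
    rw [div_eq_mul_one_div, Real.log_mul (by norm_num) (by positivity)]
    linarith
  have lβm : Real.log (2 * m / β) ≤ 3 * Λ := by
    rw [div_eq_mul_one_div, Real.log_mul (by positivity) (by positivity),
      Real.log_mul (by norm_num) (by positivity)]
    linarith
  have hG0 := hp.logFactor_pos
  have key : 20000 * √m * Λ ^ 2 ≤ p.ε * (p.α * p.b) := by
    have := mul_le_mul_of_nonneg_left h (by positivity : 0 ≤ p.ε * p.α)
    calc 20000 * √m * Λ ^ 2
        = p.ε * p.α * (20000 * (√m / (p.α * p.ε)) * Λ ^ 2) := by field_simp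
      _ ≤ _ := by linarith
  have sq : Λ ≤ Λ ^ 2 := by nlinarith
  have hΛm : √m * Λ ≤ √m * Λ ^ 2 := by gcongr
  refine ⟨?_, ?_, ?_, ?_⟩
  · have := mul_le_mul_of_nonneg_left lG hm.le
    nlinarith
  · have := mul_le_mul_of_nonneg_left lβ2 hm.le
    nlinarith
  · have h1 : p.logFactor ^ 2 ≤ (3 * Λ) ^ 2 := by gcongr
    have := mul_le_mul_of_nonneg_left h1 hm.le
    nlinarith
  · have h1 : p.logFactor * (8 + Real.log (2 * m / β)) ≤ 3 * Λ * (11 * Λ) := by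
      calc p.logFactor * (8 + Real.log (2 * m / β)) ≤ p.logFactor * (11 * Λ) := by
            gcongr
            linarith
        _ ≤ _ := by gcongr
    have := mul_le_mul_of_nonneg_left h1 hm.le
    nlinarith

theorem returns_iff (hm : 1 ≤ m) (D : Dataset n m) (ω : ℕ → unitInterval) (x : Fin n → ℝ) :
    (∃ t, Returns mechanism p.ε p.δ p.α p.b D ω x t) ↔ output p D ω = x := by
  obtain ⟨t, ⟨s, hs, hx⟩, -⟩ := exec_mechanism hm p D ω
  constructor
  · rintro ⟨t', s', hs', hx'⟩
    obtain ⟨rfl, -⟩ := hs.deterministic hs'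
    rw [← hx, ← hx']
  · rintro rfl
    exact ⟨t, s, hs, hx⟩

end Accuracy

end PrivatePacking

theorem theorem1 :
    ∃ (P : RealRAM.Program) (C : ℝ) (k : ℕ) (τ : ℕ → ℝ → ℝ → ℝ → ℝ),
      ∀ (n m : ℕ) (ε δ α b : ℝ), 1 ≤ n → 1 ≤ m →
        0 < δ → δ < 1 → 0 < ε → ε ≤ 1 + Real.log (1 / δ) → 0 < α → α < 1 → 0 < b →
        -- the program is `(ε, δ)`-jointly differentially private
        PrivatePacking.JointlyPrivate RealRAM.coins
          (fun (D : PrivatePacking.Dataset n m) ω x =>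
            ∃ t, PrivatePacking.Returns P ε δ α b D ω x t) ε δ ∧
        -- with high probability its allocation is feasible and nearly optimal, if `b` is large
        (∀ (D : PrivatePacking.Dataset n m) (β : ℝ), 0 < β → β < 1 →
          C * (Real.sqrt m / (α * ε)) * Real.log (m + 1 / α + 1 / δ + 1 / β) ^ k ≤ b →
          RealRAM.coins {ω | ¬ ∃ x t, PrivatePacking.Returns P ε δ α b D ω x t ∧
            PrivatePacking.IsNearOptimal D b (α * n) x} ≤ ENNReal.ofReal β) ∧
        -- it always returns fractions, in a number of steps that is linear in `n`
        (∀ D : PrivatePacking.Dataset n m, ∀ᵐ ω ∂(RealRAM.coins),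
          ∃ x t, PrivatePacking.Returns P ε δ α b D ω x t ∧
            (∀ i, 0 ≤ x i ∧ x i ≤ 1) ∧ (t : ℝ) ≤ τ m ε δ α * n) := by
  -- the number of rounds depends on `m`, `δ` and `α` only, so any values of `n`, `ε` and `b` will do
  refine ⟨PrivatePacking.mechanism, 20000, 2, fun m ε δ α =>
    ((⟨ε, δ, α, 1⟩ : PrivatePacking.Params 1 m).rounds + 1) * (2 * ((m + 1) * 620)), ?_⟩
  intro n m ε δ α b hn hm hδ hδ1 hε hε1 hα hα1 hb
  set p : PrivatePacking.Params n m := ⟨ε, δ, α, b⟩ with hpdef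
  have hp : p.Valid := ⟨hn, hm, hδ, hδ1, hε, hε1, hα, hα1, hb⟩
  have hret := fun (D : PrivatePacking.Dataset n m) ω x =>
    PrivatePacking.returns_iff (p := p) hm D ω x
  refine ⟨?_, ?_, ?_⟩
  · have h := PrivatePacking.output_jointlyPrivate hp
    simp only [← hret] at h
    exact h
  · intro D β hβ hβ1 hle
    refine (measure_mono ?_).trans (PrivatePacking.coins_not_isNearOptimal_le hp hβ
      (PrivatePacking.largeSupply_of_le hp hβ hβ1 hle) D)
    intro ω hω hopt
    obtain ⟨t, ht⟩ := (hret D ω _).2 rfl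
    exact hω ⟨_, t, ht, hopt⟩
  · intro D
    refine Filter.Eventually.of_forall fun ω => ?_
    obtain ⟨t, ht, hle⟩ := PrivatePacking.exec_mechanism hm p D ω
    refine ⟨_, t, ht, PrivatePacking.output_mem hp D ω, ?_⟩
    have hle' : (t : ℝ) ≤ (p.rounds + 1) * ((n + 1) * ((m + 1) * 620)) := by
      rw [PrivatePacking.Params.rounds]
      exact_mod_cast hle
    have hn' : (1 : ℝ) ≤ n := by exact_mod_cast hn
    have hr := hp.rounds_pos
    calc (t : ℝ) ≤ (p.rounds + 1) * ((n + 1) * ((m + 1) * 620)) := hle'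
      _ ≤ (p.rounds + 1) * ((n + n) * ((m + 1) * 620)) := by gcongr
      _ = (p.rounds + 1) * (2 * ((m + 1) * 620)) * n := by ring
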